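/- Let $J\subset\mathbb{R}$ be a bounded interval and let $r, C_0,\mu_0>0$. There exist constants $C,\mu>0$, depending only on $J$, $r$, $C_0$ and $\mu_0$, such that the following holds. Let $D\in\mathbb{N}$, let $\Omega\subseteq\mathbb{R}^D$ be open, let $d$ be a pseudo-metric on $\mathbb{R}^D$, and for $x\in\mathbb{R}^D$ let $\chi_x$ denote multiplication by the characteristic function of the open ball of radius $1/2$ around $x$ in the maximum norm, as an operator on $L^2(\Omega)$. Let $H$ be a (possibly unbounded) self-adjoint operator on $L^2(\Omega)$ with spectrum $\sigma(H)$ that satisfies the Combes–Thomas bound $$\|\chi_x(H-z)^{-1}\chi_y\|\le\frac{C_0}{\operatorname{dist}(z,\sigma(H))}\exp\left(\frac{-\mu_0\operatorname{dist}(z,\sigma(H))}{1+|z|+\operatorname{dist}(z,\sigma(H))}\,d(x,y)\right)$$ for all $x,y\in\mathbb{R}^D$ and all $z\in\mathbb{C}\setminus\sigma(H)$. Then for any $x,y\in\mathbb{R}^D$ there exists a smooth function $\chi:\mathbb{R}\to[0,1]$ with $\chi(E)=0$ if $\operatorname{dist}(E,J)\le r$ and $\chi(E)=1$ if $\operatorname{dist}(E,J)\ge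 2r$, such that for all $z\in\mathbb{C}\setminus\mathbb{R}$ with $\operatorname{Re}z\in J$ $$\|\chi_x\,\chi(H)(H-z)^{-1}\chi_y\|\le C\,e^{-\mu d(x,y)}.$$ -/

import Mathlib

open MeasureTheory
open scoped ENNReal ContDiff

noncomputable section

/-- The complex Hilbert space `L²(Ω)` of a set `Ω ⊆ ℝ^D`, with respect to Lebesgue measure. The space
`Fin D → ℝ` carries the maximum norm. -/
abbrev L2Space {D : ℕ} (Ω : Set (Fin D → ℝ)) : Type :=
  Lp ℂ 2 ((volume : Measure (Fin D → ℝ)).restrict Ω)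

/-- Multiplication by the indicator function of a measurable set `s`, as a map on `L²`. -/
def indicatorMulFun {D : ℕ} (Ω : Set (Fin D → ℝ)) {s : Set (Fin D → ℝ)}
    (hs : MeasurableSet s) (f : L2Space Ω) : L2Space Ω :=
  ((Lp.memLp f).indicator hs).toLp (s.indicator (f : (Fin D → ℝ) → ℂ))

theorem coeFn_indicatorMulFun {D : ℕ} (Ω : Set (Fin D → ℝ)) {s : Set (Fin D → ℝ)}
    (hs : MeasurableSet s) (f : L2Space Ω) :
    (indicatorMulFun Ω hs f : (Fin D → ℝ) → ℂ)
      =ᵐ[(volume : Measure (Fin D → ℝ)).restrict Ω] s.indicator (f : (Fin D → ℝ) → ℂ) :=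
  MemLp.coeFn_toLp _

/-- Multiplication by the indicator function of a measurable set, as a bounded operator on `L²`. -/
def indicatorMul {D : ℕ} (Ω : Set (Fin D → ℝ)) {s : Set (Fin D → ℝ)}
    (hs : MeasurableSet s) : L2Space Ω →L[ℂ] L2Space Ω :=
  LinearMap.mkContinuous
    { toFun := indicatorMulFun Ω hs
      map_add' := fun f g => by
        refine Lp.ext ?_
        filter_upwards [coeFn_indicatorMulFun Ω hs (f + g), coeFn_indicatorMulFun Ω hs f,
          coeFn_indicatorMulFun Ω hs g, Lp.coeFn_add f g,
          Lp.coeFn_add (indicatorMulFun Ω hs f) (indicatorMulFun Ω hs g)] with u h1 h2 h3 h4 h5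
        rw [h5, Pi.add_apply, h1, h2, h3]
        by_cases h : u ∈ s
        · rw [Set.indicator_of_mem h, Set.indicator_of_mem h, Set.indicator_of_mem h, h4,
            Pi.add_apply]
        · rw [Set.indicator_of_notMem h, Set.indicator_of_notMem h, Set.indicator_of_notMem h,
            add_zero]
      map_smul' := fun c f => by
        rw [RingHom.id_apply]
        refine Lp.ext ?_
        filter_upwards [coeFn_indicatorMulFun Ω hs (c • f), coeFn_indicatorMulFun Ω hs f,
          Lp.coeFn_smul c f, Lp.coeFn_smul c (indicatorMulFun Ω hs f)] with u h1 h2 h3 h4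
        rw [h4, Pi.smul_apply, h1, h2]
        by_cases h : u ∈ s
        · rw [Set.indicator_of_mem h, Set.indicator_of_mem h, h3, Pi.smul_apply]
        · rw [Set.indicator_of_notMem h, Set.indicator_of_notMem h, smul_zero] }
    1 (fun f => by
      rw [one_mul]
      refine Lp.norm_le_norm_of_ae_le ?_
      filter_upwards [coeFn_indicatorMulFun Ω hs f] with u hu
      exact (congrArg norm hu).le.trans (norm_indicator_le_norm_self _ _))

/-- The operator `χ_x` on `L²(Ω)`: multiplication by the indicator function of the open ball of
radius `1/2` around `x`, in the maximum norm. -/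
def ballCutoff {D : ℕ} (Ω : Set (Fin D → ℝ)) (x : Fin D → ℝ) : L2Space Ω →L[ℂ] L2Space Ω :=
  indicatorMul Ω (s := Metric.ball x (1 / 2)) measurableSet_ball

section Operators

variable {E : Type*} [NormedAddCommGroup E] [InnerProductSpace ℂ E]

/-- `R` is the bounded, everywhere defined, two-sided inverse of `H - z`. -/
def IsResolventAt (H : E →ₗ.[ℂ] E) (z : ℂ) (R : E →L[ℂ] E) : Prop :=
  (∀ φ : E, ∃ h : R φ ∈ H.domain, H ⟨R φ, h⟩ - z • R φ = φ) ∧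
    ∀ ψ : H.domain, R (H ψ - z • (ψ : E)) = ψ

/-- There is at most one bounded inverse of `H - z`. -/
theorem IsResolventAt.unique {H : E →ₗ.[ℂ] E} {z : ℂ} {R S : E →L[ℂ] E}
    (hR : IsResolventAt H z R) (hS : IsResolventAt H z S) : R = S := by
  ext φ
  obtain ⟨h, hφ⟩ := hS.1 φ
  have := hR.2 ⟨S φ, h⟩
  rw [hφ] at this
  exact this

/-- The spectrum `σ(H)` of an unbounded operator: the set of those `z` for which `H - z` has no
bounded inverse. -/
def opSpectrum (H : E →ₗ.[ℂ] E) : Set ℂ :=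
  {z | ¬ ∃ R : E →L[ℂ] E, IsResolventAt H z R}

open Classical in
/-- The resolvent `(H - z)⁻¹`, for `z` outside the spectrum of `H` (and `0` on the spectrum). -/
def opResolvent (H : E →ₗ.[ℂ] E) (z : ℂ) : E →L[ℂ] E :=
  if h : ∃ R : E →L[ℂ] E, IsResolventAt H z R then h.choose else 0

/-- The Cayley transform `(H - i)(H + i)⁻¹ = 1 - 2i (H + i)⁻¹`, a unitary operator if `H` is
self-adjoint. -/
def cayleyTransform (H : E →ₗ.[ℂ] E) : E →L[ℂ] E :=
  1 - (2 * Complex.I) • opResolvent H (-Complex.I)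

/-- The function on the unit circle that corresponds to `f : ℝ → ℂ` under the Cayley map
`t ↦ (t - i) / (t + i)`, whose inverse is `w ↦ i (1 + w) / (1 - w)`; the point `w = 1`, which
corresponds to the point at infinity, is sent to the limit of `f` at infinity. -/
def cayleyPullback (f : ℝ → ℂ) (w : ℂ) : ℂ :=
  open Classical in
  if w = 1 then Filter.limUnder (Filter.cocompact ℝ) f
  else f (Complex.I * (1 + w) / (1 - w)).re

/-- The functional calculus `f(H)` of a self-adjoint operator `H`, for continuous functions
`f : ℝ → ℂ` which have a limit at infinity: the continuous functional calculus of the Cayley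
transform of `H`, applied to `f` seen as a continuous function on the unit circle. -/
def opFunction [CompleteSpace E] (H : E →ₗ.[ℂ] E) (f : ℝ → ℂ) : E →L[ℂ] E :=
  cfc (cayleyPullback f) (cayleyTransform H)

end Operators

/-- The Combes–Thomas bound with constants `C₀` and `μ₀` for an operator `H` on `L²(Ω)`, with respect
to a pseudo-metric `d` on `ℝ^D`. -/
def CombesThomasBound {D : ℕ} {Ω : Set (Fin D → ℝ)} (H : L2Space Ω →ₗ.[ℂ] L2Space Ω)
    (d : PseudoMetric (Fin D → ℝ) ℝ) (C₀ μ₀ : ℝ) : Prop :=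
  ∀ (x y : Fin D → ℝ) (z : ℂ), z ∉ opSpectrum H →
    ‖ballCutoff Ω x ∘L opResolvent H z ∘L ballCutoff Ω y‖ ≤
      C₀ / Metric.infDist z (opSpectrum H) *
        Real.exp (-(μ₀ * Metric.infDist z (opSpectrum H)) /
          (1 + ‖z‖ + Metric.infDist z (opSpectrum H)) * d x y)

end

/-! The cutoff may depend on `d x y`, so it can be taken close to a rational function whose degree
grows linearly with the distance. Let `a` be the midpoint of `J` and `l` its half-length, and put `ρ
= l + 3 * r / 2`. The bump `ρ² / ((t - a)² + ρ²)` crosses `1/2` exactly at `|t - a| = ρ`, between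
the region where the cutoff must be `0` and the region where it must be `1`. Composing it with the
polynomial `binomialStep N` gives a step up to an error `q ^ N` with `q < 1`, and
`exists_cutoff_near_binomialStep` corrects this step to a genuine smooth cutoff.

The operator `T` obtained from the bump is `ρ²` times the product of the resolvents at `a ± iρ`. Let
`L` be the map `X ↦ χ_x X χ_y`. The Combes–Thomas bound controls `L` of resolvents away from the
real axis by `M ~ exp (-μ₁ d)`; Cauchy's estimate and the resolvent identity then bound `L (T ^ k *
(H - z)⁻¹)` by a multiple of `M * 16 ^ k`. For `|Im z| ≥ r / 2` the cut-off resolvent is thus at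
most a constant times `1089 ^ N * M + q ^ N`, and `N = ⌊ε d⌋` with small `ε` makes both terms decay
(`norm_map_opFunction_mul_opResolvent_le`).

Nearer to the axis, the resolvent is expanded in powers of the resolvent at `w = Re z ± i r`.
Cauchy's estimate carries the previous bound to each of the `m` terms, at a total cost of `2 ^ m`.
The remainder is at most `(3 / 4) ^ m / r`, because the cutoff vanishes where `|t - Re z| < r`.
Taking `m` proportional to `d` gives decay uniformly up to the axis
(`norm_map_opFunction_mul_opResolvent_le_of_vanishing`). -/

noncomputable section

/-! ### Resolvents of an unbounded self-adjoint operator and its Cayley transform. -/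

section Resolvent

variable {E : Type*} [NormedAddCommGroup E] [InnerProductSpace ℂ E] {H : E →ₗ.[ℂ] E}

theorem isResolventAt_opResolvent {z : ℂ} (hz : z ∉ opSpectrum H) :
    IsResolventAt H z (opResolvent H z) := by
  have h : ∃ R : E →L[ℂ] E, IsResolventAt H z R := not_not.1 hz
  rw [opResolvent, dif_pos h]
  exact h.choose_spec

/-- The first resolvent identity. -/
theorem opResolvent_sub_opResolvent {z w : ℂ} (hz : z ∉ opSpectrum H) (hw : w ∉ opSpectrum H) :
    opResolvent H z - opResolvent H w = (z - w) • (opResolvent H z * opResolvent H w) := by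
  ext φ
  obtain ⟨h, hφ⟩ := (isResolventAt_opResolvent hw).1 φ
  have h2 := (isResolventAt_opResolvent hz).2 ⟨_, h⟩
  rw [sub_eq_iff_eq_add] at hφ
  rw [hφ] at h2
  simp only [map_sub, map_add, map_smul] at h2
  change _ = (z - w) • opResolvent H z (opResolvent H w φ)
  rw [sub_apply]
  linear_combination (norm := module) h2

theorem opResolvent_commute {z w : ℂ} (hz : z ∉ opSpectrum H) (hw : w ∉ opSpectrum H) :
    Commute (opResolvent H z) (opResolvent H w) := by
  by_cases h : z = w
  · rw [h]
  have h1 := opResolvent_sub_opResolvent hz hw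
  have h2 := opResolvent_sub_opResolvent hw hz
  have h3 : (z - w) • (opResolvent H z * opResolvent H w)
      = (z - w) • (opResolvent H w * opResolvent H z) := by
    rw [← h1, ← neg_sub w z, neg_smul, ← h2, neg_sub]
  exact smul_right_injective _ (sub_ne_zero.2 h) h3

variable [CompleteSpace E]

theorem IsSelfAdjoint.inner_apply_right (hH : IsSelfAdjoint H) (φ ψ : H.domain) :
    inner ℂ (H φ) (ψ : E) = inner ℂ (φ : E) (H ψ) := by
  have h := LinearPMap.adjoint_isFormalAdjoint hH.dense_domain
  rw [LinearPMap.isSelfAdjoint_def.1 hH] at h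
  exact h φ ψ

/-- Since `⟨ψ, Hψ⟩` is real, the imaginary part of `⟨ψ, (H - z)ψ⟩` is `-Im z ‖ψ‖²`; Cauchy–Schwarz
concludes. -/
theorem IsSelfAdjoint.abs_im_mul_norm_le (hH : IsSelfAdjoint H) (z : ℂ) (ψ : H.domain) :
    |z.im| * ‖(ψ : E)‖ ≤ ‖H ψ - z • (ψ : E)‖ := by
  have h0 : (inner ℂ (ψ : E) (H ψ)).im = 0 := by
    rw [← Complex.conj_eq_iff_im, inner_conj_symm]
    exact hH.inner_apply_right ψ ψ
  have h1 : (inner ℂ (ψ : E) (H ψ - z • (ψ : E))).im = -(z.im * ‖(ψ : E)‖ ^ 2) := by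
    rw [inner_sub_right, inner_smul_right, Complex.sub_im, h0, inner_self_eq_norm_sq_to_K]
    simp [← Complex.ofReal_pow]
  have h2 : |z.im| * ‖(ψ : E)‖ ^ 2 ≤ ‖(ψ : E)‖ * ‖H ψ - z • (ψ : E)‖ := by
    calc |z.im| * ‖(ψ : E)‖ ^ 2 = |(inner ℂ (ψ : E) (H ψ - z • (ψ : E))).im| := by
          rw [h1, abs_neg, abs_mul, abs_of_nonneg (sq_nonneg ‖(ψ : E)‖)]
      _ ≤ ‖inner ℂ (ψ : E) (H ψ - z • (ψ : E))‖ := Complex.abs_im_le_norm _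
      _ ≤ _ := norm_inner_le_norm _ _
  rcases (norm_nonneg (ψ : E)).eq_or_lt with h | h
  · rw [← h, mul_zero]; positivity
  · refine le_of_mul_le_mul_left ?_ h
    linarith

/-- On the closed graph of `H`, the map `(ψ, Hψ) ↦ (H - z)ψ` is bounded below, so its range is
closed. A vector orthogonal to the range is an eigenvector of the adjoint, that is of `H`, for the
nonreal value `star z`, hence zero. -/
theorem IsSelfAdjoint.surjective_sub_smul (hH : IsSelfAdjoint H) {z : ℂ} (hz : z.im ≠ 0) (φ : E) :
    ∃ ψ : H.domain, H ψ - z • (ψ : E) = φ := by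
  have hpos : 0 < |z.im| := abs_pos.2 hz
  let G : Submodule ℂ (E × E) := H.graph
  have hGc : IsClosed (G : Set (E × E)) := hH.isClosed
  have : CompleteSpace G := hGc.completeSpace_coe
  let M : G →L[ℂ] E := (ContinuousLinearMap.snd ℂ E E - z • ContinuousLinearMap.fst ℂ E E).comp
    G.subtypeL
  have hM : ∀ p : G, M p = (p : E × E).2 - z • (p : E × E).1 := fun p => rfl
  have hG : ∀ p : G, ∃ ψ : H.domain, (ψ : E) = (p : E × E).1 ∧ H ψ = (p : E × E).2 := fun p => by
    simpa using (LinearPMap.mem_graph_iff H).1 p.2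
  have hb : ∀ p : G, ‖p‖ ≤ (1 + (1 + ‖z‖) / |z.im|) * ‖M p‖ := by
    intro p
    obtain ⟨ψ, h1, h2⟩ := hG p
    have h3 := hH.abs_im_mul_norm_le z ψ
    rw [h1, h2, ← hM, ← le_div_iff₀' hpos] at h3
    have h4 : ‖(p : E × E).2‖ ≤ ‖M p‖ + ‖z‖ * ‖(p : E × E).1‖ := by
      calc ‖(p : E × E).2‖ = ‖M p + z • (p : E × E).1‖ := by rw [hM, sub_add_cancel]
        _ ≤ _ := (norm_add_le _ _).trans_eq (by rw [norm_smul])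
    have h5 : ‖z‖ * ‖(p : E × E).1‖ ≤ ‖z‖ * (‖M p‖ / |z.im|) := by gcongr
    have h6 : (1 + (1 + ‖z‖) / |z.im|) * ‖M p‖
      = ‖M p‖ + ‖M p‖ / |z.im| + ‖z‖ * (‖M p‖ / |z.im|) := by ring
    have h7 : 0 ≤ ‖M p‖ / |z.im| := by positivity
    have h8 : 0 ≤ ‖z‖ * (‖M p‖ / |z.im|) := by positivity
    have h9 := norm_nonneg (M p)
    change max ‖(p : E × E).1‖ ‖(p : E × E).2‖ ≤ _
    rw [h6]
    exact max_le (by linarith) (by linarith)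
  have hanti : AntilipschitzWith (Real.toNNReal (1 + (1 + ‖z‖) / |z.im|)) M := by
    refine AddMonoidHomClass.antilipschitz_of_bound M fun p => ?_
    rw [Real.coe_toNNReal _ (by positivity)]
    exact hb p
  have hcl : IsClosed (LinearMap.range M.toLinearMap : Set E) := by
    exact hanti.isClosed_range M.uniformContinuous
  have horth : (LinearMap.range M.toLinearMap)ᗮ = ⊥ := by
    rw [eq_bot_iff]
    intro y hy
    have h1 : ∀ ψ : H.domain, inner ℂ (star z • y) (ψ : E) = inner ℂ y (H ψ) := by
      intro ψ
      have := Submodule.mem_orthogonal' _ _ |>.1 hy (M ⟨(ψ, H ψ), H.mem_graph ψ⟩) ⟨_, rfl⟩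
      rw [hM, inner_sub_right, sub_eq_zero] at this
      rw [this, inner_smul_left, inner_smul_right]
      simp
    have h2 : y ∈ H.adjoint.domain := LinearPMap.mem_adjoint_domain_of_exists y ⟨_, h1⟩
    have h3 := LinearPMap.adjoint_apply_eq hH.dense_domain ⟨y, h2⟩ h1
    -- A variable operator `K` lets the equality of the adjoint with `H` be substituted together
    -- with the membership in the domain.
    have key : ∀ K : E →ₗ.[ℂ] E, K = H → ∀ h : y ∈ K.domain, K ⟨y, h⟩ = star z • y → y = 0 := by
      rintro K rfl h h'
      have := hH.abs_im_mul_norm_le (star z) ⟨y, h⟩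
      rw [h'] at this
      simp only [sub_self, norm_zero] at this
      have h5 : |(star z).im| = |z.im| := by simp
      rw [h5] at this
      have h6 : ‖y‖ ≤ 0 := by
        by_contra hc
        push Not at hc
        exact absurd this (not_le.2 (mul_pos hpos hc))
      exact norm_le_zero_iff.1 h6
    exact key _ (LinearPMap.isSelfAdjoint_def.1 hH) h2 h3
  have htop : LinearMap.range M.toLinearMap = ⊤ := by
    rw [← hcl.submodule_topologicalClosure_eq, Submodule.topologicalClosure_eq_top_iff, horth]
  obtain ⟨p, hp⟩ : φ ∈ LinearMap.range M.toLinearMap := htop ▸ Submodule.mem_top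
  obtain ⟨ψ, h1, h2⟩ := hG p
  exact ⟨ψ, by rw [h1, h2]; exact hp⟩

theorem IsSelfAdjoint.exists_isResolventAt (hH : IsSelfAdjoint H) {z : ℂ} (hz : z.im ≠ 0) :
    ∃ R : E →L[ℂ] E, IsResolventAt H z R ∧ ‖R‖ ≤ |z.im|⁻¹ := by
  have hpos : 0 < |z.im| := abs_pos.2 hz
  let M : H.domain →ₗ[ℂ] E := H.toFun - z • H.domain.subtype
  have hM : ∀ ψ : H.domain, M ψ = H ψ - z • (ψ : E) := fun ψ => rfl
  have hbij : Function.Bijective M := by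
    refine ⟨(injective_iff_map_eq_zero M).2 fun ψ h => ?_, fun φ => hH.surjective_sub_smul hz φ⟩
    have := hH.abs_im_mul_norm_le z ψ
    rw [← hM, h, norm_zero] at this
    have h6 : ‖(ψ : E)‖ ≤ 0 := by
      by_contra hc
      push Not at hc
      exact absurd this (not_le.2 (mul_pos hpos hc))
    exact Subtype.ext (norm_le_zero_iff.1 h6)
  let e := LinearEquiv.ofBijective M hbij
  have he : ∀ φ, M (e.symm φ) = φ := fun φ => e.apply_symm_apply φ
  have hb : ∀ φ, ‖(H.domain.subtype ∘ₗ e.symm.toLinearMap) φ‖ ≤ |z.im|⁻¹ * ‖φ‖ := by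
    intro φ
    have := hH.abs_im_mul_norm_le z (e.symm φ)
    rw [← hM, he] at this
    rw [← div_eq_inv_mul, le_div_iff₀' hpos]
    exact this
  refine ⟨LinearMap.mkContinuous (H.domain.subtype ∘ₗ e.symm.toLinearMap) |z.im|⁻¹ hb,
    ⟨fun φ => ⟨(e.symm φ).2, he φ⟩, fun ψ => ?_⟩, LinearMap.mkContinuous_norm_le _ (by positivity) _⟩
  change ((e.symm (M ψ) : H.domain) : E) = ψ
  rw [show M ψ = e ψ from rfl, e.symm_apply_apply]

theorem IsSelfAdjoint.notMem_opSpectrum (hH : IsSelfAdjoint H) {z : ℂ} (hz : z.im ≠ 0) :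
    z ∉ opSpectrum H :=
  not_not.2 ((hH.exists_isResolventAt hz).imp fun _ h => h.1)

theorem IsSelfAdjoint.norm_opResolvent_le (hH : IsSelfAdjoint H) {z : ℂ} (hz : z.im ≠ 0) :
    ‖opResolvent H z‖ ≤ |z.im|⁻¹ := by
  obtain ⟨R, h1, h2⟩ := hH.exists_isResolventAt hz
  rwa [(isResolventAt_opResolvent (hH.notMem_opSpectrum hz)).unique h1]

theorem IsSelfAdjoint.star_opResolvent (hH : IsSelfAdjoint H) {z : ℂ} (hz : z.im ≠ 0) :
    star (opResolvent H z) = opResolvent H (star z) := by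
  have hz' : (star z).im ≠ 0 := by simpa using hz
  rw [ContinuousLinearMap.star_eq_adjoint, eq_comm, ContinuousLinearMap.eq_adjoint_iff]
  intro φ ψ
  obtain ⟨h1, h1'⟩ := (isResolventAt_opResolvent (hH.notMem_opSpectrum hz')).1 φ
  obtain ⟨h2, h2'⟩ := (isResolventAt_opResolvent (hH.notMem_opSpectrum hz)).1 ψ
  nth_rw 1 [← h2']
  nth_rw 2 [← h1']
  rw [inner_sub_left, inner_sub_right, inner_smul_left, inner_smul_right,
    ← hH.inner_apply_right ⟨_, h1⟩ ⟨_, h2⟩]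
  simp

theorem IsSelfAdjoint.abs_im_le_infDist (hH : IsSelfAdjoint H) (hne : (opSpectrum H).Nonempty)
    (z : ℂ) : |z.im| ≤ Metric.infDist z (opSpectrum H) := by
  refine (Metric.le_infDist hne).2 fun w hw => ?_
  have hw0 : w.im = 0 := by
    by_contra h
    exact hH.notMem_opSpectrum h hw
  calc |z.im| = |(z - w).im| := by rw [Complex.sub_im, hw0, sub_zero]
    _ ≤ ‖z - w‖ := Complex.abs_im_le_norm _
    _ = dist z w := (dist_eq_norm _ _).symm

/-- The adjoint is `1 + 2i (H - i)⁻¹`; both products with it reduce to `1` by the first resolvent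
identity and commutation. -/
theorem IsSelfAdjoint.cayleyTransform_mem_unitary (hH : IsSelfAdjoint H) :
    cayleyTransform H ∈ unitary (E →L[ℂ] E) := by
  have hi : (-Complex.I).im ≠ 0 := by simp
  have hi' : (Complex.I).im ≠ 0 := by simp
  have hs : star (opResolvent H (-Complex.I)) = opResolvent H Complex.I := by
    rw [hH.star_opResolvent hi]; simp
  have hU : star (cayleyTransform H) = 1 + (2 * Complex.I) • opResolvent H Complex.I := by
    rw [cayleyTransform, star_sub, star_smul, star_one, hs]
    simp [sub_eq_add_neg]
  have hc := opResolvent_commute (hH.notMem_opSpectrum hi) (hH.notMem_opSpectrum hi')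
  have hr := opResolvent_sub_opResolvent (hH.notMem_opSpectrum hi) (hH.notMem_opSpectrum hi')
  have key : (1 - (2 * Complex.I) • opResolvent H (-Complex.I)) *
      (1 + (2 * Complex.I) • opResolvent H Complex.I) = 1 := by
    have e : (1 - (2 * Complex.I) • opResolvent H (-Complex.I)) *
      (1 + (2 * Complex.I) • opResolvent H Complex.I)
      = 1 - (2 * Complex.I) • (opResolvent H (-Complex.I) - opResolvent H Complex.I)
        - ((2 * Complex.I) * (2 * Complex.I)) •
          (opResolvent H (-Complex.I) * opResolvent H Complex.I) := by
      rw [sub_mul, mul_add, mul_add, smul_mul_smul_comm, smul_sub]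
      simp only [mul_one, one_mul]
      abel
    rw [e, hr, smul_smul, sub_sub, ← add_smul]
    rw [show (2 * Complex.I * (-Complex.I - Complex.I) + 2 * Complex.I * (2 * Complex.I)) = 0 by ring,
      zero_smul, sub_zero]
  rw [Unitary.mem_iff, hU, cayleyTransform]
  refine ⟨Eq.trans ?_ key, key⟩
  have h1 : Commute (1 - (2 * Complex.I) • opResolvent H (-Complex.I)) (opResolvent H Complex.I) :=
    (Commute.one_left _).sub_left (hc.smul_left (2 * Complex.I))
  exact ((Commute.one_right _).add_right (h1.smul_right (2 * Complex.I))).eq.symm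

end Resolvent

/-! ### Cauchy estimates for powers of the resolvent. -/

section Cauchy

/-- Cauchy's estimate for the powers of an element of a Banach algebra, in terms of its resolvents. -/
theorem norm_map_pow_succ_le_of_sphere {A F : Type*} [NormedRing A] [NormedAlgebra ℂ A]
    [CompleteSpace A] [NormedAddCommGroup F] [NormedSpace ℂ F] [CompleteSpace F]
    (L : A →L[ℂ] F) (a : A) {δ M : ℝ} (hδ : 0 < δ) (ha : δ * ‖a‖ < 1)
    (hM : ∀ w : ℂ, ‖w‖ = δ → ‖L (a * Ring.inverse (1 - w • a))‖ ≤ M) (k : ℕ) :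
    ‖L (a ^ (k + 1))‖ ≤ M / δ ^ k := by
  -- The function `w ↦ L (a (1 - w a)⁻¹)` has `L (a ^ (k + 1))` as its `k`-th Taylor coefficient at
  -- `0`.
  let Λ : A →L[ℂ] F := L.comp (ContinuousLinearMap.mul ℂ A a)
  have hg := Λ.comp_hasFPowerSeriesOnBall (spectrum.hasFPowerSeriesOnBall_inverse_one_sub_smul ℂ a)
  have hball : Metric.closedBall (0 : ℂ) δ ⊆ Metric.eball (0 : ℂ) (‖a‖₊ : ℝ≥0∞)⁻¹ := by
    intro w hw
    rw [mem_closedBall_zero_iff] at hw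
    rw [Metric.mem_eball, edist_zero_right, ← one_div,
      ENNReal.lt_div_iff_mul_lt (Or.inr enorm_ne_top) (Or.inl ENNReal.coe_ne_top),
      ← enorm_eq_nnnorm, ← ofReal_norm, ← ofReal_norm, ← ENNReal.ofReal_mul (norm_nonneg _),
      ENNReal.ofReal_lt_one]
    exact (mul_le_mul_of_nonneg_right hw (norm_nonneg a)).trans_lt ha
  have hd : DiffContOnCl ℂ (Λ ∘ fun z : ℂ => Ring.inverse (1 - z • a)) (Metric.ball 0 δ) := by
    apply DifferentiableOn.diffContOnCl
    exact hg.differentiableOn.mono (Metric.closure_ball_subset_closedBall.trans hball)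
  have h1 := Complex.norm_iteratedDeriv_le_of_forall_mem_sphere_norm_le k hδ hd (C := M) (by
    intro w hw
    rw [mem_sphere_zero_iff_norm] at hw
    exact hM w hw)
  have h2 := hg.factorial_smul 1 k
  rw [iteratedDeriv_eq_iteratedFDeriv, ← h2] at h1
  have h3 : (Λ.compFormalMultilinearSeries
      (fun n => ContinuousMultilinearMap.mkPiRing ℂ (Fin n) (a ^ n))) k (fun _ => 1)
      = L (a ^ (k + 1)) := by
    change L (a * ContinuousMultilinearMap.mkPiRing ℂ (Fin k) (a ^ k) fun _ => 1) = _
    simp [pow_succ']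
  rw [h3, ← Nat.cast_smul_eq_nsmul ℝ, norm_smul, mul_div_assoc, Real.norm_natCast] at h1
  exact le_of_mul_le_mul_left h1 (by positivity)

variable {E : Type*} [NormedAddCommGroup E] [InnerProductSpace ℂ E] [CompleteSpace E]
  {H : E →ₗ.[ℂ] E}

/-- By the resolvent identity, `1 + w (H - z - w)⁻¹` is the two-sided inverse of `1 - w (H - z)⁻¹`.
This turns the abstract Cauchy estimate into one over resolvents on a circle around `z`. -/
theorem IsSelfAdjoint.opResolvent_mul_inverse (hH : IsSelfAdjoint H) {z w : ℂ} (hz : z.im ≠ 0)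
    (hw : (z + w).im ≠ 0) :
    opResolvent H z * Ring.inverse (1 - w • opResolvent H z) = opResolvent H (z + w) := by
  have h1 := opResolvent_sub_opResolvent (hH.notMem_opSpectrum hz) (hH.notMem_opSpectrum hw)
  have h2 := opResolvent_sub_opResolvent (hH.notMem_opSpectrum hw) (hH.notMem_opSpectrum hz)
  have hc := opResolvent_commute (hH.notMem_opSpectrum hz) (hH.notMem_opSpectrum hw)
  rw [sub_add_cancel_left] at h1
  rw [add_sub_cancel_left] at h2
  set A := opResolvent H z
  set B := opResolvent H (z + w)
  have e1 : (1 - w • A) * (1 + w • B) = 1 := by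
    have : (1 - w • A) * (1 + w • B) = 1 - w • (A - B) - (w * w) • (A * B) := by
      rw [sub_mul, mul_add, mul_add, smul_mul_smul_comm, smul_sub]
      simp only [mul_one, one_mul]
      abel
    rw [this, h1]
    module
  have e2 : (1 + w • B) * (1 - w • A) = 1 := by
    have : (1 + w • B) * (1 - w • A) = 1 + w • (B - A) - (w * w) • (B * A) := by
      rw [add_mul, mul_sub, mul_sub, smul_mul_smul_comm, smul_sub]
      simp only [mul_one, one_mul]
      abel
    rw [this, h2]
    module
  have e3 : Ring.inverse (1 - w • A) = 1 + w • B :=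
    Ring.inverse_unit (⟨1 - w • A, 1 + w • B, e1, e2⟩ : (E →L[ℂ] E)ˣ)
  rw [e3, mul_add, mul_one, mul_smul_comm, ← sub_eq_zero]
  linear_combination (norm := module) h1

/-- Cauchy's estimate for the powers of the resolvent. -/
theorem IsSelfAdjoint.norm_map_opResolvent_pow_succ_le (hH : IsSelfAdjoint H) {F : Type*}
    [NormedAddCommGroup F] [NormedSpace ℂ F] [CompleteSpace F]
    (L : (E →L[ℂ] E) →L[ℂ] F) {z : ℂ} {δ M : ℝ} (hδ : 0 < δ) (hz : δ < |z.im|)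
    (hM : ∀ w : ℂ, ‖w - z‖ = δ → ‖L (opResolvent H w)‖ ≤ M) (k : ℕ) :
    ‖L (opResolvent H z ^ (k + 1))‖ ≤ M / δ ^ k := by
  have hpos : 0 < |z.im| := hδ.trans hz
  have hz0 : z.im ≠ 0 := abs_pos.1 hpos
  refine norm_map_pow_succ_le_of_sphere L _ hδ ?_ (fun w hw => ?_) k
  · calc δ * ‖opResolvent H z‖ ≤ δ * |z.im|⁻¹ := by gcongr; exact hH.norm_opResolvent_le hz0
      _ < |z.im| * |z.im|⁻¹ := by gcongr
      _ = 1 := mul_inv_cancel₀ hpos.ne'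
  · have hzw : (z + w).im ≠ 0 := by
      intro h
      have h1 : |z.im| = |w.im| := by
        rw [Complex.add_im] at h
        rw [eq_neg_of_add_eq_zero_left h, abs_neg]
      have := Complex.abs_im_le_norm w
      linarith
    rw [hH.opResolvent_mul_inverse hz0 hzw]
    exact hM _ (by rw [add_sub_cancel_left, hw])

end Cauchy

/-! ### Functional calculus through the Cayley transform. -/

section FunctionalCalculus

/-- A continuous function on the real line which has a limit at infinity. -/
def ContinuousWithLimit (f : ℝ → ℂ) : Prop :=
  Continuous f ∧ ∃ l, Filter.Tendsto f (Filter.cocompact ℝ) (nhds l)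

theorem tendsto_inv_ofReal_sub_cocompact (z : ℂ) :
    Filter.Tendsto (fun t : ℝ => ((t : ℂ) - z)⁻¹) (Filter.cocompact ℝ) (nhds 0) := by
  refine Filter.tendsto_inv₀_cobounded.comp ?_
  rw [← tendsto_norm_atTop_iff_cobounded]
  refine Filter.tendsto_atTop_mono (f := fun t : ℝ => ‖t‖ - ‖z‖) (fun t => ?_)
    (Filter.tendsto_atTop_add_const_right _ _ tendsto_norm_cocompact_atTop)
  simpa using norm_sub_norm_le (t : ℂ) z

namespace ContinuousWithLimit

variable {f g : ℝ → ℂ}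

theorem const (c : ℂ) : ContinuousWithLimit fun _ => c :=
  ⟨continuous_const, c, tendsto_const_nhds⟩

theorem mul (hf : ContinuousWithLimit f) (hg : ContinuousWithLimit g) :
    ContinuousWithLimit fun t => f t * g t :=
  let ⟨l, hl⟩ := hf.2
  let ⟨m, hm⟩ := hg.2
  ⟨hf.1.mul hg.1, l * m, hl.mul hm⟩

theorem sub (hf : ContinuousWithLimit f) (hg : ContinuousWithLimit g) :
    ContinuousWithLimit fun t => f t - g t :=
  let ⟨l, hl⟩ := hf.2
  let ⟨m, hm⟩ := hg.2
  ⟨hf.1.sub hg.1, l - m, hl.sub hm⟩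

theorem pow (hf : ContinuousWithLimit f) (n : ℕ) : ContinuousWithLimit fun t => f t ^ n :=
  let ⟨l, hl⟩ := hf.2
  ⟨hf.1.pow n, l ^ n, hl.pow n⟩

theorem eval (hf : ContinuousWithLimit f) (q : Polynomial ℂ) :
    ContinuousWithLimit fun t => q.eval (f t) :=
  let ⟨l, hl⟩ := hf.2
  ⟨q.continuous.comp hf.1, q.eval l, (q.continuous.tendsto l).comp hl⟩

theorem resolvent {z : ℂ} (hz : z.im ≠ 0) : ContinuousWithLimit fun t => ((t : ℂ) - z)⁻¹ := by
  have h0 : ∀ t : ℝ, (t : ℂ) - z ≠ 0 := fun t h => hz (by rw [← sub_eq_zero.1 h]; simp)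
  exact ⟨Continuous.inv₀ (by fun_prop) h0, 0, tendsto_inv_ofReal_sub_cocompact z⟩

end ContinuousWithLimit

theorem cayleyPullback_one {f : ℝ → ℂ} {l : ℂ}
    (h : Filter.Tendsto f (Filter.cocompact ℝ) (nhds l)) : cayleyPullback f 1 = l := by
  rw [cayleyPullback, if_pos rfl]
  exact h.limUnder_eq

theorem cayleyPullback_of_ne (f : ℝ → ℂ) {w : ℂ} (hw : w ≠ 1) :
    cayleyPullback f w = f (Complex.I * (1 + w) / (1 - w)).re :=
  if_neg hw

theorem ofReal_re_cayley_inv {w : ℂ} (hw : ‖w‖ = 1) (h1 : w ≠ 1) :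
    (((Complex.I * (1 + w) / (1 - w)).re : ℝ) : ℂ) = Complex.I * (1 + w) / (1 - w) := by
  rw [← Complex.conj_eq_iff_re]
  have hw0 : w ≠ 0 := fun h => by simp [h] at hw
  have hc : (starRingEnd ℂ) w = w⁻¹ := by
    rw [Complex.inv_def, Complex.normSq_eq_norm_sq, hw]; simp
  have h2 : (1 - w) ≠ 0 := sub_ne_zero.2 h1.symm
  have h3 : (w - 1) ≠ 0 := sub_ne_zero.2 h1
  rw [map_div₀, map_mul, map_sub, map_add, map_one, hc, Complex.conj_I]
  have h4 : 1 - w⁻¹ ≠ 0 := by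
    rw [show 1 - w⁻¹ = (w - 1) / w by field_simp]
    exact div_ne_zero h3 hw0
  rw [div_eq_div_iff h4 h2]
  field_simp
  ring

/-- Only `w = 1` is delicate: on the circle `i (1 + w) / (1 - w)` is real, and its modulus tends to
infinity as `w → 1`, so `f` tends to its limit at infinity. -/
theorem continuousOn_cayleyPullback {f : ℝ → ℂ} (hf : ContinuousWithLimit f) :
    ContinuousOn (cayleyPullback f) (Metric.sphere 0 1) := by
  obtain ⟨hc, l, hl⟩ := hf
  intro w hw
  rw [mem_sphere_zero_iff_norm] at hw
  by_cases h1 : w = 1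
  · subst h1
    rw [← continuousWithinAt_sdiff_self, ContinuousWithinAt, cayleyPullback_one hl]
    have hev : ∀ᶠ w in nhdsWithin (1 : ℂ) (Metric.sphere 0 1 \ {1}), ‖w‖ = 1 ∧ w ≠ 1 := by
      filter_upwards [self_mem_nhdsWithin] with w hw
      exact ⟨mem_sphere_zero_iff_norm.1 hw.1, hw.2⟩
    have h3 : Filter.Tendsto (fun w : ℂ => (Complex.I * (1 + w) / (1 - w)).re)
        (nhdsWithin (1 : ℂ) (Metric.sphere 0 1 \ {1})) (Filter.cocompact ℝ) := by
      rw [← Metric.cobounded_eq_cocompact, ← tendsto_norm_atTop_iff_cobounded]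
      have h4 : Filter.Tendsto (fun w : ℂ => ‖1 + w‖ * ‖1 - w‖⁻¹)
          (nhdsWithin (1 : ℂ) (Metric.sphere 0 1 \ {1})) Filter.atTop := by
        have h5 : Filter.Tendsto (fun w : ℂ => ‖1 + w‖)
            (nhdsWithin (1 : ℂ) (Metric.sphere 0 1 \ {1})) (nhds ‖(1 : ℂ) + 1‖) :=
          (Continuous.tendsto (by fun_prop) _).mono_left nhdsWithin_le_nhds
        refine Filter.Tendsto.pos_mul_atTop (by norm_num) h5 (Filter.Tendsto.inv_tendsto_nhdsGT_zero ?_)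
        rw [tendsto_nhdsWithin_iff]
        constructor
        · have h6 : Filter.Tendsto (fun w : ℂ => ‖1 - w‖) (nhds 1) (nhds ‖(1 : ℂ) - 1‖) :=
            Continuous.tendsto (by fun_prop) _
          rw [sub_self, norm_zero] at h6
          exact h6.mono_left nhdsWithin_le_nhds
        · filter_upwards [hev] with w hw
          exact norm_pos_iff.2 (sub_ne_zero.2 hw.2.symm)
      refine h4.congr' ?_
      filter_upwards [hev] with w hw
      rw [← Complex.norm_real, ofReal_re_cayley_inv hw.1 hw.2, norm_div, norm_mul, Complex.norm_I,
        one_mul, div_eq_mul_inv]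
    refine (hl.comp h3).congr' ?_
    filter_upwards [hev] with w hw
    rw [cayleyPullback_of_ne f hw.2, Function.comp]
  · refine ContinuousAt.continuousWithinAt ?_
    have h2 : (1 - w) ≠ 0 := sub_ne_zero.2 (Ne.symm h1)
    have h3 : ContinuousAt (fun w : ℂ => f (Complex.I * (1 + w) / (1 - w)).re) w := by
      refine hc.continuousAt.comp (Complex.continuous_re.continuousAt.comp ?_)
      exact ContinuousAt.div (by fun_prop) (by fun_prop) h2
    refine h3.congr ?_
    filter_upwards [isOpen_ne.mem_nhds h1] with v hv
    rw [cayleyPullback_of_ne f hv]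

variable {E : Type*} [NormedAddCommGroup E] [InnerProductSpace ℂ E] [CompleteSpace E]
  {H : E →ₗ.[ℂ] E}

theorem IsSelfAdjoint.spectrum_cayleyTransform_subset (hH : IsSelfAdjoint H) :
    spectrum ℂ (cayleyTransform H) ⊆ Metric.sphere 0 1 :=
  spectrum.subset_circle_of_unitary hH.cayleyTransform_mem_unitary

theorem IsSelfAdjoint.isStarNormal_cayleyTransform (hH : IsSelfAdjoint H) :
    IsStarNormal (cayleyTransform H) :=
  isStarNormal_of_mem_unitary hH.cayleyTransform_mem_unitary

theorem IsSelfAdjoint.continuousOn_cayleyPullback (hH : IsSelfAdjoint H) {f : ℝ → ℂ}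
    (hf : ContinuousWithLimit f) :
    ContinuousOn (cayleyPullback f) (spectrum ℂ (cayleyTransform H)) :=
  (_root_.continuousOn_cayleyPullback hf).mono hH.spectrum_cayleyTransform_subset

theorem IsSelfAdjoint.opFunction_mul (hH : IsSelfAdjoint H) {f g : ℝ → ℂ}
    (hf : ContinuousWithLimit f) (hg : ContinuousWithLimit g) :
    opFunction H (fun t => f t * g t) = opFunction H f * opFunction H g := by
  have h : cayleyPullback (fun t => f t * g t)
      = fun w => cayleyPullback f w * cayleyPullback g w := by
    obtain ⟨l, hl⟩ := hf.2
    obtain ⟨m, hm⟩ := hg.2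
    funext w
    by_cases hw : w = 1
    · rw [hw, cayleyPullback_one hl, cayleyPullback_one hm, cayleyPullback_one (hl.mul hm)]
    · simp only [cayleyPullback_of_ne _ hw]
  rw [opFunction, h]
  exact cfc_mul _ _ _ (hH.continuousOn_cayleyPullback hf) (hH.continuousOn_cayleyPullback hg)

theorem IsSelfAdjoint.opFunction_sub (hH : IsSelfAdjoint H) {f g : ℝ → ℂ}
    (hf : ContinuousWithLimit f) (hg : ContinuousWithLimit g) :
    opFunction H (fun t => f t - g t) = opFunction H f - opFunction H g := by
  have h : cayleyPullback (fun t => f t - g t)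
      = fun w => cayleyPullback f w - cayleyPullback g w := by
    obtain ⟨l, hl⟩ := hf.2
    obtain ⟨m, hm⟩ := hg.2
    funext w
    by_cases hw : w = 1
    · rw [hw, cayleyPullback_one hl, cayleyPullback_one hm, cayleyPullback_one (hl.sub hm)]
    · simp only [cayleyPullback_of_ne _ hw]
  rw [opFunction, h]
  exact cfc_sub _ _ _ (hH.continuousOn_cayleyPullback hf) (hH.continuousOn_cayleyPullback hg)

theorem IsSelfAdjoint.opFunction_eval (hH : IsSelfAdjoint H) {f : ℝ → ℂ}
    (hf : ContinuousWithLimit f) (q : Polynomial ℂ) :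
    opFunction H (fun t => q.eval (f t)) = Polynomial.aeval (opFunction H f) q := by
  have h : cayleyPullback (fun t => q.eval (f t)) = fun w => q.eval (cayleyPullback f w) := by
    obtain ⟨l, hl⟩ := hf.2
    funext w
    by_cases hw : w = 1
    · rw [hw, cayleyPullback_one hl]
      exact cayleyPullback_one ((q.continuous.tendsto l).comp hl)
    · simp only [cayleyPullback_of_ne _ hw]
  rw [opFunction, h]
  exact cfc_map_polynomial q _ _ hH.isStarNormal_cayleyTransform (hH.continuousOn_cayleyPullback hf)

theorem IsSelfAdjoint.opFunction_const (hH : IsSelfAdjoint H) (c : ℂ) :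
    opFunction H (fun _ => c) = c • 1 := by
  simpa [Algebra.algebraMap_eq_smul_one] using
    hH.opFunction_eval (ContinuousWithLimit.const 0) (Polynomial.C c)

theorem IsSelfAdjoint.opFunction_pow (hH : IsSelfAdjoint H) {f : ℝ → ℂ}
    (hf : ContinuousWithLimit f) (n : ℕ) :
    opFunction H (fun t => f t ^ n) = opFunction H f ^ n := by
  simpa using hH.opFunction_eval hf (Polynomial.X ^ n)

theorem norm_opFunction_le {f : ℝ → ℂ} (hf : ContinuousWithLimit f) {c : ℝ}
    (hc : ∀ t, ‖f t‖ ≤ c) : ‖opFunction H f‖ ≤ c := by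
  refine norm_cfc_le ((norm_nonneg _).trans (hc 0)) fun w _ => ?_
  by_cases hw : w = 1
  · obtain ⟨l, hl⟩ := hf.2
    rw [hw, cayleyPullback_one hl]
    exact le_of_tendsto hl.norm (Filter.Eventually.of_forall hc)
  · rw [cayleyPullback_of_ne _ hw]
    exact hc _

/-- In the Cayley variable `w`, the function `(t + i)⁻¹` is the polynomial `(1 - w) / (2i)`. -/
theorem IsSelfAdjoint.opFunction_inv_add_I (hH : IsSelfAdjoint H) :
    opFunction H (fun t => ((t : ℂ) - -Complex.I)⁻¹) = opResolvent H (-Complex.I) := by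
  have h : Set.EqOn (cayleyPullback fun t => ((t : ℂ) - -Complex.I)⁻¹)
      (fun w => ((Polynomial.C (2 * Complex.I)⁻¹ * (1 - Polynomial.X) : Polynomial ℂ)).eval w)
      (spectrum ℂ (cayleyTransform H)) := by
    intro w hw
    have hw1 := mem_sphere_zero_iff_norm.1 (hH.spectrum_cayleyTransform_subset hw)
    simp only [Polynomial.eval_mul, Polynomial.eval_C, Polynomial.eval_sub, Polynomial.eval_one,
      Polynomial.eval_X]
    by_cases h1 : w = 1
    · rw [h1, cayleyPullback_one (tendsto_inv_ofReal_sub_cocompact _)]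
      simp
    · rw [cayleyPullback_of_ne _ h1, ofReal_re_cayley_inv hw1 h1]
      have h2 : (1 - w) ≠ 0 := sub_ne_zero.2 (Ne.symm h1)
      rw [← inv_inj, inv_inv, mul_inv, inv_inv]
      field_simp
      ring
  rw [opFunction, cfc_congr h, cfc_polynomial _ _ hH.isStarNormal_cayleyTransform]
  simp only [map_mul, map_sub, map_one, Polynomial.aeval_X, Polynomial.aeval_C, cayleyTransform,
    sub_sub_cancel, Algebra.algebraMap_eq_smul_one, smul_mul_assoc, one_mul, smul_smul]
  rw [inv_mul_cancel₀ (by simp), one_smul]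

/-- The functional calculus of `t ↦ (t - z)⁻¹` is the resolvent. -/
theorem IsSelfAdjoint.opFunction_inv_sub (hH : IsSelfAdjoint H) {z : ℂ} (hz : z.im ≠ 0) :
    opFunction H (fun t => ((t : ℂ) - z)⁻¹) = opResolvent H z := by
  have hi : (-Complex.I).im ≠ 0 := by simp
  have hne : ∀ {z : ℂ}, z.im ≠ 0 → ∀ t : ℝ, (t : ℂ) - z ≠ 0 := fun hz t h =>
    hz (by rw [← sub_eq_zero.1 h]; simp)
  -- The second factor is `(t - z) / (t + i)`. Its operator counterpart `1 - (z + i) A` has the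
  -- right inverse `1 + (z + i) B`, so the case of general `z` follows from that of `-i`.
  have h1 : ∀ t : ℝ, ((t : ℂ) - z)⁻¹ * (1 - (z + Complex.I) * ((t : ℂ) - -Complex.I)⁻¹)
      = ((t : ℂ) - -Complex.I)⁻¹ := by
    intro t
    have h2 := hne hz t
    have h3 := hne hi t
    field_simp
    ring
  have h2 := congrArg (opFunction H) (funext h1)
  have hA := ContinuousWithLimit.resolvent hi
  rw [hH.opFunction_mul (ContinuousWithLimit.resolvent hz)
    ((ContinuousWithLimit.const 1).sub ((ContinuousWithLimit.const _).mul hA)),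
    hH.opFunction_sub (ContinuousWithLimit.const 1) ((ContinuousWithLimit.const _).mul hA),
    hH.opFunction_mul (ContinuousWithLimit.const _) hA, hH.opFunction_const, hH.opFunction_const,
    hH.opFunction_inv_add_I, one_smul, smul_mul_assoc, one_mul] at h2
  have h3 := opResolvent_sub_opResolvent (hH.notMem_opSpectrum hi) (hH.notMem_opSpectrum hz)
  set A := opResolvent H (-Complex.I)
  set B := opResolvent H z
  set Q := opFunction H (fun t => ((t : ℂ) - z)⁻¹)
  have h4 : (1 - (z + Complex.I) • A) * (1 + (z + Complex.I) • B) = 1 := by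
    have : (1 - (z + Complex.I) • A) * (1 + (z + Complex.I) • B) = 1 - (z + Complex.I) • (A - B)
        - ((z + Complex.I) * (z + Complex.I)) • (A * B) := by
      rw [sub_mul, mul_add, mul_add, smul_mul_smul_comm, smul_sub]
      simp only [mul_one, one_mul]
      abel
    rw [this, h3]
    module
  calc Q = Q * (1 - (z + Complex.I) • A) * (1 + (z + Complex.I) • B) := by
        rw [mul_assoc, h4, mul_one]
    _ = A + (z + Complex.I) • (A * B) := by rw [h2, mul_add, mul_one, mul_smul_comm]
    _ = B := by
      rw [← sub_eq_zero]
      linear_combination (norm := module) h3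

end FunctionalCalculus

/-! ### Polynomial steps, smooth cutoffs close to them, and the choice of the degree. -/

section Cutoff

/-- The probability that a binomial random variable with parameters `2 N + 1` and `t` is at most
`N`. -/
def binomialStep (N : ℕ) (t : ℝ) : ℝ :=
  ∑ k ∈ Finset.range (N + 1), ((2 * N + 1).choose k : ℝ) * (t ^ k * (1 - t) ^ (2 * N + 1 - k))

theorem contDiff_binomialStep (N : ℕ) : ContDiff ℝ ∞ (binomialStep N) := by
  unfold binomialStep
  fun_prop

theorem binomialStep_nonneg (N : ℕ) {t : ℝ} (h0 : 0 ≤ t) (h1 : t ≤ 1) : 0 ≤ binomialStep N t := by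
  have : 0 ≤ 1 - t := sub_nonneg.2 h1
  exact Finset.sum_nonneg fun k _ => by positivity

/-- The number of trials is odd, so exactly one of successes and failures is at most `N`. -/
theorem binomialStep_add_binomialStep_one_sub (N : ℕ) (t : ℝ) :
    binomialStep N t + binomialStep N (1 - t) = 1 := by
  have h := add_pow t (1 - t) (2 * N + 1)
  rw [add_sub_cancel, one_pow, show 2 * N + 1 + 1 = (N + 1) + (N + 1) by ring,
    Finset.sum_range_add] at h
  refine Eq.trans ?_ h.symm
  rw [binomialStep, binomialStep]
  congr 1
  · exact Finset.sum_congr rfl fun k _ => by ring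
  · rw [← Finset.sum_range_reflect]
    refine Finset.sum_congr rfl fun k hk => ?_
    have hk' := Finset.mem_range.1 hk
    rw [sub_sub_cancel, show N + 1 - 1 - k = N - k by omega, ← Nat.choose_symm (by omega),
      show 2 * N + 1 - (N - k) = N + 1 + k by omega, show 2 * N + 1 - (N + 1 + k) = N - k by omega]
    ring

theorem binomialStep_le_one (N : ℕ) {t : ℝ} (h0 : 0 ≤ t) (h1 : t ≤ 1) : binomialStep N t ≤ 1 := by
  have := binomialStep_nonneg N (sub_nonneg.2 h1) (sub_le_self 1 h0)
  linarith [binomialStep_add_binomialStep_one_sub N t]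

/-- For `k ≤ N` and `1 - t ≤ t`, moving the surplus factors `1 - t` to `t` bounds each term by `(t
(1 - t)) ^ N`; the lower half of the binomial coefficients sums to `4 ^ N`. -/
theorem binomialStep_le_pow (N : ℕ) {t : ℝ} (h0 : 1 / 2 ≤ t) (h1 : t ≤ 1) :
    binomialStep N t ≤ (4 * (t * (1 - t))) ^ N := by
  have hs : 0 ≤ 1 - t := sub_nonneg.2 h1
  have ht : 0 ≤ t := by linarith
  calc binomialStep N t
      ≤ ∑ k ∈ Finset.range (N + 1), ((2 * N + 1).choose k : ℝ) * (t * (1 - t)) ^ N := by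
        refine Finset.sum_le_sum fun k hk => ?_
        have hk' := Finset.mem_range.1 hk
        gcongr
        obtain ⟨j, rfl⟩ : ∃ j, N = k + j := ⟨N - k, by omega⟩
        rw [show 2 * (k + j) + 1 - k = k + 2 * j + 1 by omega]
        calc t ^ k * (1 - t) ^ (k + 2 * j + 1)
            = (t * (1 - t)) ^ k * ((1 - t) * (1 - t)) ^ j * (1 - t) := by
              generalize 1 - t = s
              ring
          _ ≤ (t * (1 - t)) ^ k * (t * (1 - t)) ^ j * 1 := by
              gcongr <;> linarith
          _ = _ := by ring
    _ = (4 * (t * (1 - t))) ^ N := by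
        rw [← Finset.sum_mul, ← Nat.cast_sum, Nat.sum_range_choose_halfway, mul_pow 4]
        push_cast
        rfl

theorem one_sub_binomialStep_le_pow (N : ℕ) {t : ℝ} (h0 : 0 ≤ t) (h1 : t ≤ 1 / 2) :
    1 - binomialStep N t ≤ (4 * (t * (1 - t))) ^ N := by
  have h := binomialStep_le_pow N (t := 1 - t) (by linarith) (by linarith)
  rw [sub_sub_cancel, mul_comm (1 - t)] at h
  linarith [binomialStep_add_binomialStep_one_sub N t]

/-- The Cauchy bump `t ↦ ρ² / ((t - a)² + ρ²)`. -/
def cauchyBump (a ρ t : ℝ) : ℝ := ρ ^ 2 / ((t - a) ^ 2 + ρ ^ 2)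

theorem cauchyBump_pos {ρ : ℝ} (hρ : 0 < ρ) (a t : ℝ) : 0 < cauchyBump a ρ t := by
  unfold cauchyBump; positivity

theorem cauchyBump_le_one {ρ : ℝ} (hρ : 0 < ρ) (a t : ℝ) : cauchyBump a ρ t ≤ 1 := by
  rw [cauchyBump, div_le_one (by positivity)]
  nlinarith [sq_nonneg (t - a)]

theorem cauchyBump_le_cauchyBump {ρ : ℝ} (hρ : 0 < ρ) {a s t : ℝ} (h : |t - a| ≤ |s - a|) :
    cauchyBump a ρ s ≤ cauchyBump a ρ t := by
  have := sq_le_sq.2 h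
  unfold cauchyBump
  gcongr

theorem contDiff_cauchyBump {ρ : ℝ} (hρ : 0 < ρ) (a : ℝ) : ContDiff ℝ ∞ (cauchyBump a ρ) := by
  unfold cauchyBump
  exact contDiff_const.div (by fun_prop) fun t => by positivity

/-- A smooth function which vanishes for `|t - a| ≤ A` and equals one for `|t - a| ≥ B`. -/
def outerCutoff (a A B t : ℝ) : ℝ :=
  Real.smoothTransition (((t - a) ^ 2 - A ^ 2) / (B ^ 2 - A ^ 2))

theorem contDiff_outerCutoff (a A B : ℝ) : ContDiff ℝ ∞ (outerCutoff a A B) :=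
  Real.smoothTransition.contDiff.comp (by fun_prop)

theorem outerCutoff_eq_zero {a A B t : ℝ} (hA : 0 ≤ A) (hAB : A < B) (ht : |t - a| ≤ A) :
    outerCutoff a A B t = 0 := by
  refine Real.smoothTransition.zero_of_nonpos (div_nonpos_of_nonpos_of_nonneg ?_ ?_)
  · rw [sub_nonpos, ← sq_abs (t - a)]; gcongr
  · rw [sub_nonneg]; gcongr

theorem outerCutoff_eq_one {a A B t : ℝ} (hA : 0 ≤ A) (hAB : A < B) (ht : B ≤ |t - a|) :
    outerCutoff a A B t = 1 := by
  have h1 : A ^ 2 < B ^ 2 := by gcongr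
  have h2 : B ^ 2 ≤ (t - a) ^ 2 := by rw [← sq_abs (t - a)]; have := hA.trans hAB.le; gcongr
  refine Real.smoothTransition.one_of_one_le ?_
  rw [one_le_div (by linarith)]
  linarith

theorem outerCutoff_mem_Icc (a A B t : ℝ) : outerCutoff a A B t ∈ Set.Icc (0 : ℝ) 1 :=
  ⟨Real.smoothTransition.nonneg _, Real.smoothTransition.le_one _⟩

/-- Smooth cutoffs which are exponentially close to the functions `binomialStep N ∘ cauchyBump`. -/
theorem exists_cutoff_near_binomialStep (a : ℝ) {l r : ℝ} (hl : 0 ≤ l) (hr : 0 < r) :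
    ∃ q : ℝ, 0 < q ∧ q < 1 ∧ ∀ N : ℕ, ∃ χ : ℝ → ℝ, ContDiff ℝ ∞ χ ∧
      (∀ t, χ t ∈ Set.Icc (0 : ℝ) 1) ∧ (∀ t, |t - a| ≤ l + r → χ t = 0) ∧
      (∀ t, l + 2 * r ≤ |t - a| → χ t = 1) ∧
      ∀ t, |χ t - binomialStep N (cauchyBump a (l + 3 * r / 2) t)| ≤ q ^ N := by
  set ρ : ℝ := l + 3 * r / 2 with hρd
  have hρ : 0 < ρ := by positivity
  set A₁ : ℝ := l + 4 * r / 3 with hA₁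
  set A₂ : ℝ := l + 5 * r / 3 with hA₂
  have hA₁p : 0 < A₁ := by positivity
  have hA₂p : 0 < A₂ := by positivity
  set t₁ := cauchyBump a ρ (a + A₁) with ht₁
  set t₂ := cauchyBump a ρ (a + A₂) with ht₂
  have h1 : 1 / 2 < t₁ := by
    rw [ht₁, cauchyBump, add_sub_cancel_left, div_lt_div_iff₀ (by norm_num) (by positivity)]
    have : A₁ ^ 2 < ρ ^ 2 := by gcongr; linarith
    linarith
  have h2 : t₂ < 1 / 2 := by
    rw [ht₂, cauchyBump, add_sub_cancel_left, div_lt_div_iff₀ (by positivity) (by norm_num)]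
    have : ρ ^ 2 < A₂ ^ 2 := by gcongr; linarith
    linarith
  have ht₁1 := cauchyBump_le_one hρ a (a + A₁)
  have ht₂0 := cauchyBump_pos hρ a (a + A₂)
  -- Since `4 t (1 - t) < 1` unless `t = 1 / 2`, the values `t₁ > 1 / 2 > t₂` of the bump at the
  -- radii `A₁ < ρ < A₂` give a rate below `1`.
  refine ⟨max (4 * (t₁ * (1 - t₁))) (4 * (t₂ * (1 - t₂))), lt_max_of_lt_right (by nlinarith),
    max_lt (by nlinarith [sq_pos_of_pos (sub_pos.2 h1)])
      (by nlinarith [sq_pos_of_pos (sub_pos.2 h2)]), fun N => ?_⟩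
  set q := max (4 * (t₁ * (1 - t₁))) (4 * (t₂ * (1 - t₂)))
  set Q : ℝ → ℝ := fun t => binomialStep N (cauchyBump a ρ t) with hQ
  have hQ0 : ∀ t, 0 ≤ Q t := fun t =>
    binomialStep_nonneg N (cauchyBump_pos hρ a t).le (cauchyBump_le_one hρ a t)
  have hQ1 : ∀ t, Q t ≤ 1 := fun t =>
    binomialStep_le_one N (cauchyBump_pos hρ a t).le (cauchyBump_le_one hρ a t)
  have hin : ∀ t, |t - a| ≤ A₁ → Q t ≤ q ^ N := by
    intro t ht
    have h3 : t₁ ≤ cauchyBump a ρ t :=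
      cauchyBump_le_cauchyBump hρ (by rwa [add_sub_cancel_left, abs_of_pos hA₁p])
    have h4 := cauchyBump_le_one hρ a t
    refine (binomialStep_le_pow N (h1.le.trans h3) h4).trans (pow_le_pow_left₀ ?_ ?_ N)
    · nlinarith
    · refine le_trans ?_ (le_max_left _ _)
      nlinarith
  have hout : ∀ t, A₂ ≤ |t - a| → 1 - Q t ≤ q ^ N := by
    intro t ht
    have h3 : cauchyBump a ρ t ≤ t₂ :=
      cauchyBump_le_cauchyBump hρ (by rwa [add_sub_cancel_left, abs_of_pos hA₂p])
    have h4 := cauchyBump_pos hρ a t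
    refine (one_sub_binomialStep_le_pow N h4.le (h3.trans h2.le)).trans (pow_le_pow_left₀ ?_ ?_ N)
    · nlinarith
    · refine le_trans ?_ (le_max_right _ _)
      nlinarith
  set u : ℝ → ℝ := outerCutoff a (l + r) A₁
  set v : ℝ → ℝ := outerCutoff a A₂ (l + 2 * r)
  have hu : ∀ t, u t ∈ Set.Icc (0 : ℝ) 1 := outerCutoff_mem_Icc _ _ _
  have hv : ∀ t, v t ∈ Set.Icc (0 : ℝ) 1 := outerCutoff_mem_Icc _ _ _
  have hQs : ContDiff ℝ ∞ Q := (contDiff_binomialStep N).comp (contDiff_cauchyBump hρ a)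
  have hus : ContDiff ℝ ∞ u := contDiff_outerCutoff _ _ _
  have hvs : ContDiff ℝ ∞ v := contDiff_outerCutoff _ _ _
  have hq0 : 0 ≤ q ^ N := (hQ0 a).trans (hin a (by simpa using hA₁p.le))
  -- The factor `u` alters `Q` only for `|t - a| < A₁`, where `Q` is already at most `q ^ N`; `v`
  -- alters it only for `|t - a| > A₂`, where `1 - Q` is.
  refine ⟨fun t => u t * ((1 - v t) * Q t + v t),
    hus.mul (((contDiff_const.sub hvs).mul hQs).add hvs), fun t => ?_, fun t ht => ?_, fun t ht => ?_,
    fun t => ?_⟩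
  · have h3 : 0 ≤ (1 - v t) * Q t := mul_nonneg (sub_nonneg.2 (hv t).2) (hQ0 t)
    have h4 : (1 - v t) * Q t ≤ (1 - v t) * 1 :=
      mul_le_mul_of_nonneg_left (hQ1 t) (sub_nonneg.2 (hv t).2)
    exact ⟨mul_nonneg (hu t).1 (add_nonneg h3 (hv t).1),
      mul_le_one₀ (hu t).2 (add_nonneg h3 (hv t).1) (by linarith)⟩
  · have : u t = 0 := outerCutoff_eq_zero (by positivity) (by linarith) ht
    simp only [this, zero_mul]
  · have h3 : u t = 1 := outerCutoff_eq_one (by positivity) (by linarith) (by linarith)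
    have h4 : v t = 1 := outerCutoff_eq_one (by positivity) (by linarith) ht
    simp only [h3, h4]
    ring
  · change |u t * ((1 - v t) * Q t + v t) - Q t| ≤ q ^ N
    rcases le_total |t - a| A₁ with h | h
    · have h4 : v t = 0 := outerCutoff_eq_zero hA₂p.le (by linarith) (by linarith)
      rw [h4, show u t * ((1 - 0) * Q t + 0) - Q t = -((1 - u t) * Q t) by ring, abs_neg,
        abs_of_nonneg (mul_nonneg (sub_nonneg.2 (hu t).2) (hQ0 t))]
      exact (mul_le_of_le_one_left (hQ0 t) (by linarith [(hu t).1])).trans (hin t h)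
    · have h3 : u t = 1 := outerCutoff_eq_one (by positivity) (by linarith) h
      rw [h3, show 1 * ((1 - v t) * Q t + v t) - Q t = v t * (1 - Q t) by ring,
        abs_of_nonneg (mul_nonneg (hv t).1 (sub_nonneg.2 (hQ1 t)))]
      rcases le_total |t - a| A₂ with h' | h'
      · have h4 : v t = 0 := outerCutoff_eq_zero hA₂p.le (by linarith) h'
        rwa [h4, zero_mul]
      · exact (mul_le_of_le_one_left (sub_nonneg.2 (hQ1 t)) (hv t).2).trans (hout t h')

theorem exists_pow_floor_mul_exp_add_pow_floor_le {K q μ : ℝ} (hK : 1 < K) (hq : 0 < q)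
    (hq1 : q < 1) (hμ : 0 < μ) :
    ∃ ε C μ' : ℝ, 0 < C ∧ 0 < μ' ∧ ∀ d : ℝ, 0 ≤ d →
      K ^ ⌊ε * d⌋₊ * Real.exp (-μ * d) ≤ C * Real.exp (-μ' * d) ∧
        q ^ ⌊ε * d⌋₊ ≤ C * Real.exp (-μ' * d) := by
  have hlK : 0 < Real.log K := Real.log_pos hK
  have hlq : Real.log q < 0 := Real.log_neg hq hq1
  -- With this choice `K ^ (ε d) = exp (μ d / 2)`, which uses up half of the available decay. The
  -- constant `q⁻¹` below pays for rounding down the exponent.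
  set ε := μ / (2 * Real.log K) with hε
  have hεp : 0 < ε := by positivity
  refine ⟨ε, q⁻¹, min (μ / 2) (-(ε * Real.log q)), by positivity,
    lt_min (by positivity) (by nlinarith), fun d hd => ⟨?_, ?_⟩⟩
  · have h1 : K ^ ⌊ε * d⌋₊ ≤ Real.exp (μ / 2 * d) := by
      rw [← Real.rpow_natCast, Real.rpow_def_of_pos (by linarith), Real.exp_le_exp]
      calc Real.log K * ⌊ε * d⌋₊ ≤ Real.log K * (ε * d) := by
            gcongr; exact Nat.floor_le (by positivity)
        _ = μ / 2 * d := by rw [hε]; field_simp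
    calc K ^ ⌊ε * d⌋₊ * Real.exp (-μ * d) ≤ Real.exp (μ / 2 * d) * Real.exp (-μ * d) := by gcongr
      _ = 1 * Real.exp (-(μ / 2) * d) := by rw [← Real.exp_add, one_mul]; ring_nf
      _ ≤ _ := by
        gcongr
        · exact (one_le_inv₀ hq).2 hq1.le
        · exact min_le_left _ _
  · have h1 : q ^ ⌊ε * d⌋₊ ≤ q⁻¹ * Real.exp (ε * Real.log q * d) := by
      rw [← Real.rpow_natCast, Real.rpow_def_of_pos hq, ← Real.exp_log (inv_pos.2 hq), Real.log_inv,
        ← Real.exp_add, Real.exp_le_exp]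
      nlinarith [(Nat.lt_floor_add_one (ε * d)).le]
    refine h1.trans ?_
    have h2 : ε * Real.log q ≤ -min (μ / 2) (-(ε * Real.log q)) := by
      linarith [min_le_right (μ / 2) (-(ε * Real.log q))]
    gcongr

end Cutoff

/-! ### Localized bounds on the cut-off resolvent, away from the real axis and near it. -/

section Estimates

variable {E : Type*} [NormedAddCommGroup E] [InnerProductSpace ℂ E] {H : E →ₗ.[ℂ] E}
  {F : Type*} [NormedAddCommGroup F] [NormedSpace ℂ F]

/-- The resolvent identity writes a product of two resolvents as their difference divided by `z -
w`, so `L` of a product is controlled by `L` of single resolvents, although `L` is not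
multiplicative. -/
theorem norm_map_opResolvent_mul_opResolvent_mul_le (L : (E →L[ℂ] E) →L[ℂ] F) {z w : ℂ}
    (hz : z ∉ opSpectrum H) (hw : w ∉ opSpectrum H) (X : E →L[ℂ] E) {κ M : ℝ} (hκ : 0 < κ)
    (hzw : κ ≤ ‖z - w‖) (hMz : ‖L (opResolvent H z * X)‖ ≤ M)
    (hMw : ‖L (opResolvent H w * X)‖ ≤ M) :
    ‖L (opResolvent H z * (opResolvent H w * X))‖ ≤ 2 * M / κ := by
  have h := congrArg (fun Y => L (Y * X)) (opResolvent_sub_opResolvent hz hw)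
  simp only [sub_mul, smul_mul_assoc, mul_assoc, map_sub, map_smul] at h
  rw [le_div_iff₀' hκ]
  calc κ * ‖L (opResolvent H z * (opResolvent H w * X))‖
      ≤ ‖z - w‖ * ‖L (opResolvent H z * (opResolvent H w * X))‖ := by gcongr
    _ = ‖L (opResolvent H z * X) - L (opResolvent H w * X)‖ := by rw [h, norm_smul]
    _ ≤ 2 * M := (norm_sub_le _ _).trans (by linarith)

/-- The circles of radius `ρ / 4` and `ρ / 2` around `c` are `ρ / 4` apart, so `z` is at least `ρ /
8` away from one of them. -/
theorem exists_radius_avoiding {ρ : ℝ} (hρ : 0 < ρ) (c z : ℂ) :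
    ∃ δ, ρ / 4 ≤ δ ∧ δ ≤ ρ / 2 ∧ ∀ w : ℂ, ‖w - c‖ = δ → ρ / 8 ≤ ‖w - z‖ := by
  have htri : ∀ w : ℂ, |‖w - c‖ - ‖z - c‖| ≤ ‖w - z‖ := fun w => by
    simpa using abs_norm_sub_norm_le (w - c) (z - c)
  rcases le_total ‖z - c‖ (3 * ρ / 8) with h | h
  · refine ⟨ρ / 2, by linarith, le_rfl, fun w hw => ?_⟩
    have := (le_abs_self _).trans (htri w)
    linarith
  · refine ⟨ρ / 4, le_rfl, by linarith, fun w hw => ?_⟩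
    have := (neg_le_abs _).trans (htri w)
    linarith

/-- A geometric expansion of the resolvent. -/
theorem opResolvent_eq_sum_add {z w : ℂ} (hz : z ∉ opSpectrum H) (hw : w ∉ opSpectrum H) (m : ℕ) :
    opResolvent H z = ∑ k ∈ Finset.range m, (z - w) ^ k • opResolvent H w ^ (k + 1)
      + (z - w) ^ m • (opResolvent H w ^ m * opResolvent H z) := by
  induction m with
  | zero => simp
  | succ m ih =>
    have h : opResolvent H z = opResolvent H w + (z - w) • (opResolvent H w * opResolvent H z) := by
      rw [← (opResolvent_commute hz hw).eq, ← opResolvent_sub_opResolvent hz hw, add_sub_cancel]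
    nth_rw 1 [ih]
    rw [Finset.sum_range_succ, add_assoc]
    congr 1
    nth_rw 1 [h]
    rw [mul_add, smul_add, mul_smul_comm, smul_smul, ← pow_succ, ← pow_succ, ← mul_assoc, ← pow_succ]

/-- The polynomial `∑_{k ≤ N} (2N+1 choose k) X^k (1 - X)^(2N+1-k)`. -/
def binomialStepPolynomial (N : ℕ) : Polynomial ℂ :=
  ∑ k ∈ Finset.range (N + 1), ((2 * N + 1).choose k : Polynomial ℂ) *
    (Polynomial.X ^ k * (1 - Polynomial.X) ^ (2 * N + 1 - k))

theorem eval_binomialStepPolynomial (N : ℕ) (t : ℝ) :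
    (binomialStepPolynomial N).eval (t : ℂ) = (binomialStep N t : ℂ) := by
  simp [binomialStepPolynomial, binomialStep, Polynomial.eval_finsetSum]

/-- Each factor `T` costs `16` and each factor `1 - T` costs `1 + 16 = 17`; the binomial theorem
sums the terms to `(16 + 17) ^ (2 * N + 1)`. -/
theorem norm_map_aeval_binomialStepPolynomial_mul_le {A : Type*} [NormedRing A] [NormedAlgebra ℂ A]
    (L : A →L[ℂ] F) (T X : A) {M : ℝ} (hM0 : 0 ≤ M)
    (hM : ∀ k : ℕ, ‖L (T ^ k * X)‖ ≤ M * 16 ^ k) (N : ℕ) :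
    ‖L (Polynomial.aeval T (binomialStepPolynomial N) * X)‖ ≤ M * 33 ^ (2 * N + 1) := by
  have h1 : ∀ j k : ℕ, ‖L (T ^ k * (1 - T) ^ j * X)‖ ≤ M * (16 ^ k * 17 ^ j) := by
    intro j
    induction j with
    | zero => intro k; simpa using hM k
    | succ j ih =>
      intro k
      have : T ^ k * (1 - T) ^ (j + 1) * X
          = T ^ k * (1 - T) ^ j * X - T ^ (k + 1) * (1 - T) ^ j * X := by
        rw [pow_succ', pow_succ]
        noncomm_ring
      rw [this, map_sub]
      refine (norm_sub_le _ _).trans ((add_le_add (ih k) (ih (k + 1))).trans_eq ?_)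
      ring
  have h2 : Polynomial.aeval T (binomialStepPolynomial N) * X = ∑ k ∈ Finset.range (N + 1),
      ((2 * N + 1).choose k : ℂ) • (T ^ k * (1 - T) ^ (2 * N + 1 - k) * X) := by
    simp [binomialStepPolynomial, Finset.sum_mul, Nat.cast_smul_eq_nsmul, nsmul_eq_mul, mul_assoc]
  rw [h2, map_sum]
  calc ‖∑ k ∈ Finset.range (N + 1), L (((2 * N + 1).choose k : ℂ) •
        (T ^ k * (1 - T) ^ (2 * N + 1 - k) * X))‖
      ≤ ∑ k ∈ Finset.range (N + 1), ((2 * N + 1).choose k : ℝ) *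
          (M * (16 ^ k * 17 ^ (2 * N + 1 - k))) := by
        refine norm_sum_le_of_le _ fun k _ => ?_
        rw [map_smul, norm_smul, Complex.norm_natCast]
        gcongr
        exact h1 _ _
    _ ≤ ∑ k ∈ Finset.range (2 * N + 1 + 1), ((2 * N + 1).choose k : ℝ) *
          (M * (16 ^ k * 17 ^ (2 * N + 1 - k))) := by
        refine Finset.sum_le_sum_of_subset_of_nonneg
          (Finset.range_mono (by omega)) fun k _ _ => by positivity
    _ = M * 33 ^ (2 * N + 1) := by
        rw [show (33 : ℝ) = 16 + 17 by norm_num, add_pow, Finset.mul_sum]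
        exact Finset.sum_congr rfl fun k _ => by ring

variable [CompleteSpace E] [CompleteSpace F]

theorem IsSelfAdjoint.norm_map_opResolvent_pow_mul_le (hH : IsSelfAdjoint H)
    (L : (E →L[ℂ] E) →L[ℂ] F) (X : E →L[ℂ] E) {z : ℂ} {δ M : ℝ} (hδ : 0 < δ) (hz : δ < |z.im|)
    (hM : ∀ w : ℂ, ‖w - z‖ = δ → ‖L (opResolvent H w * X)‖ ≤ M) (k : ℕ) :
    ‖L (opResolvent H z ^ (k + 1) * X)‖ ≤ M / δ ^ k :=
  hH.norm_map_opResolvent_pow_succ_le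
    (L.comp ((ContinuousLinearMap.mul ℂ (E →L[ℂ] E)).flip X)) hδ hz hM k

/-- Bounds on the resolvent near `a ± i ρ` and at `z` control the powers of the operator
`ρ² ((H - a)² + ρ²)⁻¹`, multiplied by the resolvent at `z`. -/
theorem IsSelfAdjoint.norm_map_smul_opResolvent_pow_mul_le (hH : IsSelfAdjoint H)
    (L : (E →L[ℂ] E) →L[ℂ] F) {a ρ M : ℝ} (hρ : 0 < ρ)
    (hM : ∀ w : ℂ, ρ / 2 ≤ |w.im| → |w.re - a| ≤ ρ → ‖L (opResolvent H w)‖ ≤ M)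
    {z : ℂ} (hz : z.im ≠ 0) (hMz : ‖L (opResolvent H z)‖ ≤ M) (k : ℕ) :
    ‖L ((((ρ : ℂ) ^ 2) • (opResolvent H ⟨a, ρ⟩ * opResolvent H ⟨a, -ρ⟩)) ^ k * opResolvent H z)‖
      ≤ 16 * M * 16 ^ k := by
  have hM0 : 0 ≤ M := (norm_nonneg _).trans hMz
  rcases k with - | k
  · simp only [pow_zero, one_mul, mul_one]
    linarith
  -- The point `z` may lie close to `a ± iρ`, so the radii of the Cauchy circles are chosen to keep
  -- away from it.
  obtain ⟨δ₁, h₁, h₁', hz₁⟩ := exists_radius_avoiding hρ ⟨a, ρ⟩ z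
  obtain ⟨δ₂, h₂, h₂', hz₂⟩ := exists_radius_avoiding hρ ⟨a, -ρ⟩ z
  have hδ₁ : 0 < δ₁ := by linarith
  have hδ₂ : 0 < δ₂ := by linarith
  have near₁ : ∀ w : ℂ, ‖w - ⟨a, ρ⟩‖ = δ₁ → ρ / 2 ≤ w.im ∧ |w.re - a| ≤ ρ := by
    intro w hw
    have hre := Complex.abs_re_le_norm (w - ⟨a, ρ⟩)
    have him := Complex.abs_im_le_norm (w - ⟨a, ρ⟩)
    rw [hw] at hre him
    simp only [Complex.sub_re, Complex.sub_im] at hre him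
    exact ⟨by linarith [(abs_le.1 him).1], by linarith⟩
  have near₂ : ∀ w : ℂ, ‖w - ⟨a, -ρ⟩‖ = δ₂ → w.im ≤ -(ρ / 2) ∧ |w.re - a| ≤ ρ := by
    intro w hw
    have hre := Complex.abs_re_le_norm (w - ⟨a, -ρ⟩)
    have him := Complex.abs_im_le_norm (w - ⟨a, -ρ⟩)
    rw [hw] at hre him
    simp only [Complex.sub_re, Complex.sub_im] at hre him
    exact ⟨by linarith [(abs_le.1 him).2], by linarith⟩
  have hMw : ∀ w : ℂ, ρ / 2 ≤ |w.im| → |w.re - a| ≤ ρ → ρ / 8 ≤ ‖w - z‖ →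
      ‖L (opResolvent H w * opResolvent H z)‖ ≤ 2 * M / (ρ / 8) := by
    intro w h1 h2 h3
    have hw : w.im ≠ 0 := abs_pos.1 (by linarith)
    simpa using norm_map_opResolvent_mul_opResolvent_mul_le L (hH.notMem_opSpectrum hw)
      (hH.notMem_opSpectrum hz) 1 (by positivity) h3 (by simpa using hM w h1 h2) (by simpa using hMz)
  have hz₁' : (⟨a, ρ⟩ : ℂ).im ≠ 0 := hρ.ne'
  have hz₂' : (⟨a, -ρ⟩ : ℂ).im ≠ 0 := (neg_lt_zero.2 hρ).ne
  -- The two circles lie in opposite half-planes. Two uses of the resolvent identity, each with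
  -- separation at least `ρ / 8`, give `(2 * 8 / ρ)² = 256 / ρ²`.
  have step : ∀ w₁ w₂ : ℂ, ‖w₁ - ⟨a, ρ⟩‖ = δ₁ → ‖w₂ - ⟨a, -ρ⟩‖ = δ₂ →
      ‖L (opResolvent H w₁ * (opResolvent H w₂ * opResolvent H z))‖ ≤ 256 * M / ρ ^ 2 := by
    intro w₁ w₂ hw₁ hw₂
    have hn₁ := near₁ w₁ hw₁
    have hn₂ := near₂ w₂ hw₂
    have ha₁ : ρ / 2 ≤ |w₁.im| := hn₁.1.trans (le_abs_self _)
    have ha₂ : ρ / 2 ≤ |w₂.im| := by linarith [neg_le_abs w₂.im]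
    have hd : ρ / 8 ≤ ‖w₁ - w₂‖ := by
      have := (le_abs_self _).trans (Complex.abs_im_le_norm (w₁ - w₂))
      rw [Complex.sub_im] at this
      linarith
    refine (norm_map_opResolvent_mul_opResolvent_mul_le L
      (hH.notMem_opSpectrum (abs_pos.1 (by linarith))) (hH.notMem_opSpectrum
        (abs_pos.1 (by linarith))) _ (by positivity) hd (hMw w₁ ha₁ hn₁.2 (hz₁ w₁ hw₁))
      (hMw w₂ ha₂ hn₂.2 (hz₂ w₂ hw₂))).trans_eq ?_
    field_simp
    ring
  -- Cauchy's estimate is applied in `w₁` with `w₂` fixed, and then in `w₂`.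
  have step₁ : ∀ w₂ : ℂ, ‖w₂ - ⟨a, -ρ⟩‖ = δ₂ →
      ‖L (opResolvent H w₂ * (opResolvent H ⟨a, ρ⟩ ^ (k + 1) * opResolvent H z))‖
        ≤ 256 * M / ρ ^ 2 / δ₁ ^ k := by
    intro w₂ hw₂
    have hw₂' : w₂.im ≠ 0 := by linarith [(near₂ w₂ hw₂).1] |> fun h : w₂.im < 0 => h.ne
    have hc := (opResolvent_commute (hH.notMem_opSpectrum hw₂')
      (hH.notMem_opSpectrum hz₁')).pow_right (k + 1)
    rw [← mul_assoc, hc.eq, mul_assoc]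
    exact hH.norm_map_opResolvent_pow_mul_le L _ hδ₁
      (by rw [abs_of_pos hρ]; linarith) (fun w₁ hw₁ => step w₁ w₂ hw₁ hw₂) k
  have step₂ := hH.norm_map_opResolvent_pow_mul_le L
    (opResolvent H ⟨a, ρ⟩ ^ (k + 1) * opResolvent H z) hδ₂
      (by rw [abs_neg, abs_of_pos hρ]; linarith) step₁ k
  have hc := opResolvent_commute (hH.notMem_opSpectrum hz₁') (hH.notMem_opSpectrum hz₂')
  rw [smul_pow, hc.eq, hc.symm.mul_pow, smul_mul_assoc, map_smul, norm_smul, mul_assoc]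
  calc ‖((ρ : ℂ) ^ 2) ^ (k + 1)‖ * ‖L (opResolvent H ⟨a, -ρ⟩ ^ (k + 1) *
        (opResolvent H ⟨a, ρ⟩ ^ (k + 1) * opResolvent H z))‖
      ≤ (ρ ^ 2) ^ (k + 1) * (256 * M / ρ ^ 2 / (ρ / 4) ^ k / (ρ / 4) ^ k) := by
        rw [norm_pow, norm_pow, Complex.norm_real, Real.norm_of_nonneg hρ.le]
        gcongr
        refine step₂.trans ?_
        gcongr
    _ = 16 * M * 16 ^ (k + 1) := by
        rw [div_pow, show (16 : ℝ) ^ (k + 1) = 4 ^ k * 4 ^ k * 16 by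
          rw [← mul_pow, pow_succ]; norm_num]
        field_simp
        ring

theorem IsSelfAdjoint.opFunction_cauchyBump (hH : IsSelfAdjoint H) (a : ℝ) {ρ : ℝ} (hρ : 0 < ρ) :
    ContinuousWithLimit (fun t => (cauchyBump a ρ t : ℂ)) ∧
      opFunction H (fun t => (cauchyBump a ρ t : ℂ))
        = ((ρ : ℂ) ^ 2) • (opResolvent H ⟨a, ρ⟩ * opResolvent H ⟨a, -ρ⟩) := by
  have hz₁ : (⟨a, ρ⟩ : ℂ).im ≠ 0 := hρ.ne'
  have hz₂ : (⟨a, -ρ⟩ : ℂ).im ≠ 0 := (neg_lt_zero.2 hρ).ne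
  have hf : (fun t => (cauchyBump a ρ t : ℂ))
      = fun t : ℝ => (ρ : ℂ) ^ 2 * (((t : ℂ) - ⟨a, ρ⟩)⁻¹ * ((t : ℂ) - ⟨a, -ρ⟩)⁻¹) := by
    funext t
    have e₁ : (⟨a, ρ⟩ : ℂ) = a + ρ * Complex.I := by apply Complex.ext <;> simp
    have e₂ : (⟨a, -ρ⟩ : ℂ) = a - ρ * Complex.I := by apply Complex.ext <;> simp
    have e₃ : ((t : ℂ) - a) ^ 2 + (ρ : ℂ) ^ 2
        = ((t : ℂ) - (a + ρ * Complex.I)) * ((t : ℂ) - (a - ρ * Complex.I)) := by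
      linear_combination ((ρ : ℂ) ^ 2) * Complex.I_sq
    rw [cauchyBump, e₁, e₂, ← mul_inv, ← e₃, ← div_eq_mul_inv]
    push_cast
    rfl
  have hr₁ := ContinuousWithLimit.resolvent hz₁
  have hr₂ := ContinuousWithLimit.resolvent hz₂
  rw [hf, hH.opFunction_mul (ContinuousWithLimit.const _) (hr₁.mul hr₂), hH.opFunction_mul hr₁ hr₂,
    hH.opFunction_const, hH.opFunction_inv_sub hz₁, hH.opFunction_inv_sub hz₂, smul_mul_assoc,
    one_mul]
  exact ⟨(ContinuousWithLimit.const _).mul (hr₁.mul hr₂), rfl⟩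

/-- The bound on the cut-off resolvent away from the real axis. -/
theorem IsSelfAdjoint.norm_map_opFunction_mul_opResolvent_le (hH : IsSelfAdjoint H)
    {L : (E →L[ℂ] E) →L[ℂ] F} (hL : ∀ X, ‖L X‖ ≤ ‖X‖) {a ρ M q : ℝ} (hρ : 0 < ρ)
    (hM : ∀ w : ℂ, ρ / 2 ≤ |w.im| → |w.re - a| ≤ ρ → ‖L (opResolvent H w)‖ ≤ M)
    {f : ℝ → ℂ} (hf : ContinuousWithLimit f) {N : ℕ}
    (hfN : ∀ t, ‖f t - binomialStep N (cauchyBump a ρ t)‖ ≤ q ^ N)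
    {z : ℂ} (hz : z.im ≠ 0) (hMz : ‖L (opResolvent H z)‖ ≤ M) :
    ‖L (opFunction H f * opResolvent H z)‖ ≤ 528 * M * 1089 ^ N + q ^ N * |z.im|⁻¹ := by
  have hM0 : 0 ≤ M := (norm_nonneg _).trans hMz
  obtain ⟨hb, hbH⟩ := hH.opFunction_cauchyBump a hρ
  set T := ((ρ : ℂ) ^ 2) • (opResolvent H ⟨a, ρ⟩ * opResolvent H ⟨a, -ρ⟩)
  have h1 := norm_map_aeval_binomialStepPolynomial_mul_le L T (opResolvent H z)
    (M := 16 * M) (by positivity) (hH.norm_map_smul_opResolvent_pow_mul_le L hρ hM hz hMz) N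
  have h2 : ‖opFunction H f - Polynomial.aeval T (binomialStepPolynomial N)‖ ≤ q ^ N := by
    rw [← hbH, ← hH.opFunction_eval hb, ← hH.opFunction_sub hf (hb.eval _)]
    refine norm_opFunction_le (hf.sub (hb.eval _)) fun t => ?_
    rw [eval_binomialStepPolynomial]
    exact hfN t
  have h3 : opFunction H f * opResolvent H z
      = Polynomial.aeval T (binomialStepPolynomial N) * opResolvent H z
        + (opFunction H f - Polynomial.aeval T (binomialStepPolynomial N)) * opResolvent H z := by
    rw [sub_mul, add_sub_cancel]
  rw [h3, map_add]
  refine (norm_add_le _ _).trans (add_le_add (h1.trans_eq ?_) ((hL _).trans ?_))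
  · rw [pow_succ, pow_mul]; norm_num; ring
  · have := (norm_nonneg _).trans h2
    exact (norm_mul_le _ _).trans (by gcongr; exact hH.norm_opResolvent_le hz)

/-- The bound on the cut-off resolvent at distance at most `r` from the real axis follows from the
bound away from the real axis, since the cutoff vanishes near the real part of the point. -/
theorem IsSelfAdjoint.norm_map_opFunction_mul_opResolvent_le_of_vanishing (hH : IsSelfAdjoint H)
    {L : (E →L[ℂ] E) →L[ℂ] F} (hL : ∀ X, ‖L X‖ ≤ ‖X‖) {r M : ℝ} (hr : 0 < r)
    {f : ℝ → ℂ} (hf : ContinuousWithLimit f) (hf1 : ∀ t, ‖f t‖ ≤ 1)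
    {z : ℂ} (hz : z.im ≠ 0) (hzr : |z.im| ≤ r) (hf0 : ∀ t, |t - z.re| < r → f t = 0)
    (hM : ∀ w : ℂ, r / 2 ≤ |w.im| → |w.re - z.re| ≤ r / 2 →
      ‖L (opFunction H f * opResolvent H w)‖ ≤ M) (m : ℕ) :
    ‖L (opFunction H f * opResolvent H z)‖ ≤ 2 ^ m * M + (3 / 4) ^ m * r⁻¹ := by
  -- The centre `w = Re z + i s` is taken on the same side of the axis as `z`, whence `|z - w| ≤ r`.
  obtain ⟨s, hs, hsr⟩ : ∃ s : ℝ, |s| = r ∧ |z.im - s| ≤ r := by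
    have := abs_le.1 hzr
    rcases le_total 0 z.im with h | h
    · exact ⟨r, abs_of_pos hr, abs_le.2 ⟨by linarith, by linarith⟩⟩
    · exact ⟨-r, by rw [abs_neg, abs_of_pos hr], abs_le.2 ⟨by linarith, by linarith⟩⟩
  set w : ℂ := ⟨z.re, s⟩ with hw
  have hwim : w.im ≠ 0 := abs_pos.1 (by rw [hw]; linarith)
  have hM0 : 0 ≤ M := (norm_nonneg _).trans
    (hM w (by rw [hw]; linarith) (by rw [hw]; simp only [sub_self, abs_zero]; linarith))
  have hzw : ‖z - w‖ ≤ r := by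
    have e : z - w = ((z.im - s : ℝ) : ℂ) * Complex.I := by apply Complex.ext <;> simp [hw]
    rwa [e, norm_mul, Complex.norm_I, mul_one, Complex.norm_real]
  have h1 : ∀ k, ‖L (opFunction H f * opResolvent H w ^ (k + 1))‖ ≤ M / (r / 2) ^ k := by
    refine hH.norm_map_opResolvent_pow_succ_le
      (L.comp (ContinuousLinearMap.mul ℂ (E →L[ℂ] E) (opFunction H f))) (by positivity)
      (by rw [hw]; linarith) fun v hv => hM v ?_ ?_
    · have := Complex.abs_im_le_norm (v - w)
      rw [hv, Complex.sub_im, abs_sub_comm] at this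
      have h' := abs_sub_abs_le_abs_sub w.im v.im
      have : |w.im| = r := hs
      linarith
    · have := Complex.abs_re_le_norm (v - w)
      rwa [hv] at this
  have hrz := ContinuousWithLimit.resolvent hz
  have hrw := ContinuousWithLimit.resolvent hwim
  have h2 : ‖(z - w) ^ m • (opFunction H f * (opResolvent H w ^ m * opResolvent H z))‖
      ≤ (3 / 4) ^ m * r⁻¹ := by
    rw [← hH.opFunction_inv_sub hz, ← hH.opFunction_inv_sub hwim, ← hH.opFunction_pow hrw,
      ← hH.opFunction_mul (hrw.pow m) hrz, ← hH.opFunction_mul hf ((hrw.pow m).mul hrz), norm_smul,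
      norm_pow]
    calc ‖z - w‖ ^ m * ‖opFunction H fun t => f t * (((t : ℂ) - w)⁻¹ ^ m * ((t : ℂ) - z)⁻¹)‖
        ≤ r ^ m * ((4 * r / 3)⁻¹ ^ m * r⁻¹) := by
          gcongr
          refine norm_opFunction_le (hf.mul ((hrw.pow m).mul hrz)) fun t => ?_
          rcases lt_or_ge |t - z.re| r with h | h
          · rw [hf0 t h, zero_mul, norm_zero]; positivity
          · have hsq : r ^ 2 ≤ (t - z.re) ^ 2 := by rw [← sq_abs (t - z.re)]; gcongr
            have e1 : r ≤ ‖(t : ℂ) - z‖ := by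
              refine h.trans ?_
              simpa using Complex.abs_re_le_norm ((t : ℂ) - z)
            -- Both coordinates of `t - w` have modulus at least `r`, and `√2 > 4 / 3`. With `|z -
            -- w| ≤ r` this gives the ratio `3 / 4`.
            have e2 : 4 * r / 3 ≤ ‖(t : ℂ) - w‖ := by
              refine le_of_sq_le_sq ?_ (norm_nonneg _)
              rw [← Complex.normSq_eq_norm_sq, Complex.normSq_apply]
              simp only [hw, Complex.sub_re, Complex.sub_im, Complex.ofReal_re, Complex.ofReal_im]
              have : s ^ 2 = r ^ 2 := by rw [← sq_abs s, hs]
              nlinarith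
            rw [norm_mul, norm_mul, norm_pow, norm_inv, norm_inv]
            calc ‖f t‖ * (‖(t : ℂ) - w‖⁻¹ ^ m * ‖(t : ℂ) - z‖⁻¹)
                ≤ 1 * ((4 * r / 3)⁻¹ ^ m * r⁻¹) := by
                  gcongr
                  exact hf1 t
              _ = _ := one_mul _
      _ = (3 / 4) ^ m * r⁻¹ := by
          rw [← mul_assoc, ← mul_pow]
          congr 2
          field_simp
  rw [opResolvent_eq_sum_add (hH.notMem_opSpectrum hz) (hH.notMem_opSpectrum hwim) m, mul_add,
    map_add, Finset.mul_sum, map_sum, mul_smul_comm]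
  refine (norm_add_le _ _).trans (add_le_add ?_ ((hL _).trans h2))
  calc ‖∑ k ∈ Finset.range m, L (opFunction H f * (z - w) ^ k • opResolvent H w ^ (k + 1))‖
      ≤ ∑ k ∈ Finset.range m, 2 ^ k * M := by
        refine norm_sum_le_of_le _ fun k _ => ?_
        rw [mul_smul_comm, map_smul, norm_smul, norm_pow]
        calc ‖z - w‖ ^ k * ‖L (opFunction H f * opResolvent H w ^ (k + 1))‖
            ≤ r ^ k * (M / (r / 2) ^ k) := by gcongr; exact h1 k
          _ = 2 ^ k * M := by rw [div_pow]; field_simp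
    _ = (2 ^ m - 1) * M := by
        rw [← Finset.sum_mul, geom_sum_eq (by norm_num)]
        norm_num
    _ ≤ 2 ^ m * M := by gcongr; linarith

end Estimates

/-! ### From the Combes–Thomas bound to exponential decay of the cut-off resolvent. -/

section Main

theorem norm_ballCutoff_le {D : ℕ} (Ω : Set (Fin D → ℝ)) (x : Fin D → ℝ) :
    ‖ballCutoff Ω x‖ ≤ 1 := by
  unfold ballCutoff indicatorMul
  exact LinearMap.mkContinuous_norm_le _ zero_le_one _

theorem continuousWithLimit_of_eq_one {χ : ℝ → ℝ} (hχ : Continuous χ) {a A : ℝ}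
    (h : ∀ t, A ≤ |t - a| → χ t = 1) : ContinuousWithLimit fun t => (χ t : ℂ) := by
  refine ⟨Complex.continuous_ofReal.comp hχ, 1, ?_⟩
  refine tendsto_const_nhds.congr' ?_
  filter_upwards [tendsto_norm_cocompact_atTop.eventually_ge_atTop (A + |a|)] with t ht
  have := abs_sub_abs_le_abs_sub t a
  rw [Real.norm_eq_abs] at ht
  rw [h t (by linarith), Complex.ofReal_one]

/-- The Combes–Thomas bound in a region which is bounded in the real direction and keeps away from
the real axis. -/
theorem CombesThomasBound.norm_le {D : ℕ} {Ω : Set (Fin D → ℝ)} {H : L2Space Ω →ₗ.[ℂ] L2Space Ω}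
    {d : PseudoMetric (Fin D → ℝ) ℝ} {C₀ μ₀ : ℝ} (hCT : CombesThomasBound H d C₀ μ₀)
    (hH : IsSelfAdjoint H) (hC₀ : 0 < C₀) (hμ₀ : 0 < μ₀) {η B : ℝ} (hη : 0 < η) (hB : 0 ≤ B)
    (x y : Fin D → ℝ) {w : ℂ} (hw : η ≤ |w.im|) (hwB : |w.re| ≤ B) :
    ‖ballCutoff Ω x ∘L opResolvent H w ∘L ballCutoff Ω y‖
      ≤ C₀ / η * Real.exp (-(μ₀ * η / (1 + B + 2 * η)) * d x y) := by
  have hd : 0 ≤ d x y := d.nonneg x y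
  refine (hCT x y w (hH.notMem_opSpectrum (abs_pos.1 (hη.trans_le hw)))).trans ?_
  rcases (opSpectrum H).eq_empty_or_nonempty with h | h
  -- For an empty spectrum `infDist` is `0`, so the right side of the assumed bound is `0`.
  · rw [h, Metric.infDist_empty, div_zero, zero_mul]
    positivity
  · have h1 := hH.abs_im_le_infDist h w
    set δ := Metric.infDist w (opSpectrum H)
    have h2 : ‖w‖ ≤ B + |w.im| := (Complex.norm_le_abs_re_add_abs_im w).trans (by linarith)
    have h3 := norm_nonneg w
    have h4 : η ≤ δ := hw.trans h1
    have h5 : 0 < δ := hη.trans_le h4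
    -- As `‖w‖ ≤ B + δ`, the right side is at least `μ₀ δ / (1 + B + 2δ)`, which increases with `δ ≥
    -- η`.
    have h6 : μ₀ * η / (1 + B + 2 * η) ≤ μ₀ * δ / (1 + ‖w‖ + δ) := by
      rw [div_le_div_iff₀ (by positivity) (by positivity), mul_assoc, mul_assoc]
      refine mul_le_mul_of_nonneg_left ?_ hμ₀.le
      have h7 : η * ‖w‖ ≤ δ * B + η * δ := by
        calc η * ‖w‖ ≤ η * (B + |w.im|) := by gcongr
          _ = η * B + η * |w.im| := by ring
          _ ≤ _ := by gcongr
      nlinarith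
    rw [neg_div]
    gcongr

/-- The cut-off resolvents of all self-adjoint operators decay exponentially if their resolvents do
so away from the real axis. -/
theorem exists_cutoff_decay (a : ℝ) {l r : ℝ} (hl : 0 ≤ l) (hr : 0 < r) {C₁ μ₁ : ℝ} (hC₁ : 0 < C₁)
    (hμ₁ : 0 < μ₁) :
    ∃ C μ : ℝ, 0 < C ∧ 0 < μ ∧ ∀ d : ℝ, 0 ≤ d → ∃ χ : ℝ → ℝ, ContDiff ℝ ∞ χ ∧
      (∀ t, χ t ∈ Set.Icc (0 : ℝ) 1) ∧ (∀ t, |t - a| ≤ l + r → χ t = 0) ∧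
      (∀ t, l + 2 * r ≤ |t - a| → χ t = 1) ∧
      ∀ {E F : Type} [NormedAddCommGroup E] [InnerProductSpace ℂ E] [CompleteSpace E]
        [NormedAddCommGroup F] [NormedSpace ℂ F] [CompleteSpace F] (H : E →ₗ.[ℂ] E),
        IsSelfAdjoint H → ∀ L : (E →L[ℂ] E) →L[ℂ] F, (∀ X, ‖L X‖ ≤ ‖X‖) →
        (∀ w : ℂ, r / 2 ≤ |w.im| → |w.re - a| ≤ l + 3 * r / 2 →
          ‖L (opResolvent H w)‖ ≤ C₁ * Real.exp (-μ₁ * d)) →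
        ∀ z : ℂ, z.im ≠ 0 → |z.re - a| ≤ l →
          ‖L (opFunction H (fun t => (χ t : ℂ)) * opResolvent H z)‖ ≤ C * Real.exp (-μ * d) := by
  obtain ⟨q, hq, hq1, hχ⟩ := exists_cutoff_near_binomialStep a hl hr
  -- Two successive balances: `1089 ^ N = 33 ^ (2 * N)` against the given rate `μ₁`, then `2 ^ m`
  -- from the geometric expansion against the resulting rate `μ₂`.
  obtain ⟨ε₂, C₂, μ₂, hC₂, hμ₂, h₂⟩ :=
    exists_pow_floor_mul_exp_add_pow_floor_le (K := 1089) (by norm_num) hq hq1 hμ₁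
  obtain ⟨ε₃, C₃, μ₃, hC₃, hμ₃, h₃⟩ := exists_pow_floor_mul_exp_add_pow_floor_le (K := 2) (q := 3 / 4)
    (by norm_num) (by norm_num) (by norm_num) hμ₂
  set C₄ : ℝ := 528 * C₁ * C₂ + C₂ * (r / 2)⁻¹ with hC₄
  have hC₄p : 0 < C₄ := by positivity
  refine ⟨C₄ + C₄ * C₃ + C₃ * r⁻¹, min μ₂ μ₃, by positivity, lt_min hμ₂ hμ₃, fun d hd => ?_⟩
  obtain ⟨χ, hχs, hχI, hχ0, hχ1, hχN⟩ := hχ ⌊ε₂ * d⌋₊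
  refine ⟨χ, hχs, hχI, hχ0, hχ1, fun {E F} _ _ _ _ _ _ H hH L hL hM z hz hza => ?_⟩
  set M := C₁ * Real.exp (-μ₁ * d)
  have hf : ContinuousWithLimit fun t => (χ t : ℂ) :=
    continuousWithLimit_of_eq_one hχs.continuous hχ1
  have away : ∀ w : ℂ, r / 2 ≤ |w.im| → |w.re - a| ≤ l + 3 * r / 2 →
      ‖L (opFunction H (fun t => (χ t : ℂ)) * opResolvent H w)‖ ≤ C₄ * Real.exp (-μ₂ * d) := by
    intro w hw hwa
    have hw0 : 0 < |w.im| := by linarith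
    have h := hH.norm_map_opFunction_mul_opResolvent_le hL (ρ := l + 3 * r / 2) (a := a)
      (by positivity) (fun v hv hva => hM v (by linarith) hva) hf
      (N := ⌊ε₂ * d⌋₊) (q := q) (fun t => by
        rw [← Complex.ofReal_sub, Complex.norm_real]; exact hχN t) (abs_pos.1 hw0) (hM w hw hwa)
    obtain ⟨h5, h6⟩ := h₂ d hd
    calc ‖L (opFunction H (fun t => (χ t : ℂ)) * opResolvent H w)‖
        ≤ 528 * C₁ * (1089 ^ ⌊ε₂ * d⌋₊ * Real.exp (-μ₁ * d)) + q ^ ⌊ε₂ * d⌋₊ * |w.im|⁻¹ :=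
          h.trans_eq (by ring)
      _ ≤ 528 * C₁ * (C₂ * Real.exp (-μ₂ * d)) + C₂ * Real.exp (-μ₂ * d) * (r / 2)⁻¹ := by gcongr
      _ = C₄ * Real.exp (-μ₂ * d) := by rw [hC₄]; ring
  have e₂ : Real.exp (-μ₂ * d) ≤ Real.exp (-min μ₂ μ₃ * d) := by
    gcongr; exact min_le_left _ _
  have e₃ : Real.exp (-μ₃ * d) ≤ Real.exp (-min μ₂ μ₃ * d) := by
    gcongr; exact min_le_right _ _
  set e := Real.exp (-min μ₂ μ₃ * d)
  have he : 0 < e := Real.exp_pos _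
  rcases le_total (r / 2) |z.im| with h | h
  · refine (away z h (by linarith)).trans ?_
    have : 0 < C₄ * C₃ + C₃ * r⁻¹ := by positivity
    gcongr
    linarith
  · have hc := hH.norm_map_opFunction_mul_opResolvent_le_of_vanishing hL hr hf
      (fun t => by
        rw [Complex.norm_real, Real.norm_of_nonneg (hχI t).1]; exact (hχI t).2) hz (by linarith)
      (fun t ht => by
        have : |t - a| ≤ |t - z.re| + |z.re - a| := abs_sub_le _ _ _
        rw [hχ0 t (by linarith), Complex.ofReal_zero])
      (fun w hw hwz => away w hw (by
        have : |w.re - a| ≤ |w.re - z.re| + |z.re - a| := abs_sub_le _ _ _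
        linarith)) ⌊ε₃ * d⌋₊
    obtain ⟨h5, h6⟩ := h₃ d hd
    calc ‖L (opFunction H (fun t => (χ t : ℂ)) * opResolvent H z)‖
        ≤ C₄ * (2 ^ ⌊ε₃ * d⌋₊ * Real.exp (-μ₂ * d)) + (3 / 4) ^ ⌊ε₃ * d⌋₊ * r⁻¹ :=
          hc.trans_eq (by ring)
      _ ≤ C₄ * (C₃ * e) + C₃ * e * r⁻¹ :=
          add_le_add (mul_le_mul_of_nonneg_left (h5.trans (by gcongr)) hC₄p.le)
            (mul_le_mul_of_nonneg_right (h6.trans (by gcongr)) (by positivity))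
      _ ≤ (C₄ + C₄ * C₃ + C₃ * r⁻¹) * e := by nlinarith [mul_pos hC₄p he]

/-- The distance to a nonempty bounded interval, in terms of its midpoint and its half-length. -/
theorem exists_midpoint_of_ordConnected {J : Set ℝ} (hJ : J.OrdConnected)
    (hJb : Bornology.IsBounded J) (hne : J.Nonempty) :
    ∃ a l : ℝ, 0 ≤ l ∧ (∀ t ∈ J, |t - a| ≤ l) ∧
      ∀ t, Metric.infDist t J = max (|t - a| - l) 0 := by
  have hbd := isBounded_iff_bddBelow_bddAbove.1 hJb
  set u := sInf J
  set v := sSup J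
  have huv : u ≤ v := csInf_le_csSup hne hbd.1 hbd.2
  have hmem : ∀ t ∈ J, u ≤ t ∧ t ≤ v := fun t ht => ⟨csInf_le hbd.1 ht, le_csSup hbd.2 ht⟩
  have hin : ∀ t ∈ J, |t - (u + v) / 2| ≤ (v - u) / 2 := fun t ht => by
    have := hmem t ht
    exact abs_le.2 ⟨by linarith, by linarith⟩
  refine ⟨(u + v) / 2, (v - u) / 2, by linarith, hin, fun t => le_antisymm ?_ (max_le ?_ ?_)⟩
  · by_cases ht : t ∈ J
    · rw [Metric.infDist_zero_of_mem ht]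
      exact le_max_right _ _
    refine le_of_forall_pos_le_add fun ε hε => ?_
    -- A point outside an interval has the whole interval on one side, so the distance is approached
    -- near the supremum or the infimum.
    have hside : (∀ s ∈ J, s ≤ t) ∨ ∀ s ∈ J, t ≤ s := by
      by_contra! hc
      obtain ⟨⟨s, hs, hts⟩, s', hs', hts'⟩ := hc
      exact ht (hJ.out hs' hs ⟨hts'.le, hts.le⟩)
    rcases hside with h | h
    · obtain ⟨s, hs, hvs⟩ := exists_lt_of_lt_csSup hne (sub_lt_self v hε)
      refine (Metric.infDist_le_dist_of_mem hs).trans ?_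
      rw [Real.dist_eq, abs_of_nonneg (sub_nonneg.2 (h s hs))]
      linarith [le_abs_self (t - (u + v) / 2), le_max_left (|t - (u + v) / 2| - (v - u) / 2) 0]
    · obtain ⟨s, hs, hus⟩ := exists_lt_of_csInf_lt hne (lt_add_of_pos_right u hε)
      refine (Metric.infDist_le_dist_of_mem hs).trans ?_
      rw [Real.dist_eq, abs_of_nonpos (sub_nonpos.2 (h s hs))]
      linarith [neg_le_abs (t - (u + v) / 2), le_max_left (|t - (u + v) / 2| - (v - u) / 2) 0]
  · refine (Metric.le_infDist hne).2 fun s hs => ?_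
    have := abs_sub_le t s ((u + v) / 2)
    rw [Real.dist_eq]
    linarith [hin s hs]
  · exact Metric.infDist_nonneg

end Main

end

theorem theoremB1 (J : Set ℝ) (hJ : J.OrdConnected) (hJb : Bornology.IsBounded J)
    (r : ℝ) (hr : 0 < r) (C₀ μ₀ : ℝ) (hC₀ : 0 < C₀) (hμ₀ : 0 < μ₀) :
    ∃ C μ : ℝ, 0 < C ∧ 0 < μ ∧
      ∀ (D : ℕ) (Ω : Set (Fin D → ℝ)), IsOpen Ω →
      ∀ (d : PseudoMetric (Fin D → ℝ) ℝ) (H : L2Space Ω →ₗ.[ℂ] L2Space Ω),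
        IsSelfAdjoint H → CombesThomasBound H d C₀ μ₀ →
        ∀ x y : Fin D → ℝ, ∃ χ : ℝ → ℝ,
          ContDiff ℝ ∞ χ ∧ (∀ t, χ t ∈ Set.Icc (0 : ℝ) 1) ∧
          (∀ t, Metric.infDist t J ≤ r → χ t = 0) ∧
          (∀ t, 2 * r ≤ Metric.infDist t J → χ t = 1) ∧
          ∀ z : ℂ, z.im ≠ 0 → z.re ∈ J →
            ‖ballCutoff Ω x ∘L (opFunction H (fun t => (χ t : ℂ)) ∘L opResolvent H z) ∘L
                ballCutoff Ω y‖ ≤ C * Real.exp (-μ * d x y) := by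
  rcases J.eq_empty_or_nonempty with rfl | hne
  -- For empty `J`, `infDist` is `0` everywhere: the cutoff must vanish identically, and the
  -- condition for the value `1` is void because `2 * r > 0`.
  · refine ⟨1, 1, one_pos, one_pos, fun D Ω _ d H _ _ x y => ⟨fun _ => 0, contDiff_const,
      fun _ => ⟨le_rfl, zero_le_one⟩, fun _ _ => rfl, fun t ht => ?_, fun z _ hz => hz.elim⟩⟩
    rw [Metric.infDist_empty] at ht
    linarith
  obtain ⟨a, l, hl, hJa, hdist⟩ := exists_midpoint_of_ordConnected hJ hJb hne
  set B : ℝ := |a| + (l + 3 * r / 2) with hB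
  have hBp : 0 ≤ B := by positivity
  obtain ⟨C, μ, hC, hμ, h⟩ := exists_cutoff_decay a hl hr (C₁ := C₀ / (r / 2))
    (μ₁ := μ₀ * (r / 2) / (1 + B + 2 * (r / 2))) (by positivity) (by positivity)
  refine ⟨C, μ, hC, hμ, fun D Ω _ d H hH hCT x y => ?_⟩
  obtain ⟨χ, h1, h2, h3, h4, h5⟩ := h (d x y) (d.nonneg x y)
  refine ⟨χ, h1, h2, fun t ht => h3 t ?_, fun t ht => h4 t ?_, fun z hz hzJ => ?_⟩
  · rw [hdist] at ht
    linarith [le_max_left (|t - a| - l) 0]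
  · rw [hdist] at ht
    rcases le_max_iff.1 ht with h' | h' <;> linarith
  -- Here `L` is the contraction `X ↦ χ_x X χ_y`.
  · refine h5 H hH (ContinuousLinearMap.mulLeftRight ℂ (L2Space Ω →L[ℂ] L2Space Ω)
      (ballCutoff Ω x) (ballCutoff Ω y)) (fun X => ?_) (fun w hw hwa => ?_) z hz (hJa _ hzJ)
    · calc ‖ballCutoff Ω x * X * ballCutoff Ω y‖
          ≤ ‖ballCutoff Ω x‖ * ‖X‖ * ‖ballCutoff Ω y‖ :=
            (norm_mul_le _ _).trans (by gcongr; exact norm_mul_le _ _)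
        _ ≤ 1 * ‖X‖ * 1 := by gcongr <;> exact norm_ballCutoff_le Ω _
        _ = ‖X‖ := by ring
    · refine hCT.norm_le hH hC₀ hμ₀ (by positivity) hBp x y hw ?_
      have := abs_sub_abs_le_abs_sub w.re a
      linarith
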